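/- **Definitions.** Let $F_0(n)=n+1$ and $F_{d+1}(n)=F_d^{\,n+1}(n)$ (the $(n+1)$-fold iterate of $F_d$ applied to $n$). Fix a countably infinite set of counters. A configuration maps each counter to a natural number, with finite support. A program is an increment, decrement or zero-test command on a counter, or is of the form $\mathbf{loop}\,M$ (iterate $M$ any finite number of times), $M_1;M_2$ or $M_1\ \mathbf{or}\ M_2$; a decrement command is executable only if the counter is positive, and a test command only if the counter is zero. The size of a program is the number of its commands and connectives. Write $\alpha\xrightarrow{M}\beta$ if some execution of $M$ leads from $\alpha$ to $\beta$. A checking program is a program $M;\mathbf{test}(c_1);\dots;\mathbf{test}(c_k)$, $k\ge 0$, where $M$ contains no test command. A $K$-preamplifier for a triple of distinct counters $(x,y,b)$ is a checking program $A$ such that * every configuration $\beta$ with $0\xrightarrow{A}\beta$ satisfies $\beta(y)\ge\beta(b)\beta(x)$ and $\beta(c)=0$ for all counters $c\notin\{x,y,b\}$, and moreover $\beta(b)=K$ if $\beta(y)=\beta(b)\beta(x)$; * for every $\ell\ge 1$ there is a configuration $\beta$ with $0\xrightarrow{A}\beta$, $\beta(y)=\beta(b)\beta(x)$ and $\beta(x)=\ell$.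 A counter used by $A$ is safe if it is none of $x,y,b$ and does not occur in a test command of $A$. **Statement.** There are an algorithm (on a unit-cost random access machine with addition and subtraction, writing the program in prefix notation), a constant $C$, and a triple of counters $(x,y,b)$ such that, for all integers $d\ge 1$ and $n\ge 0$, the algorithm on input $(d,n)$ halts and outputs a $K$-preamplifier for $(x,y,b)$ with $K=2^{F_{d+1}(n)}$ which uses exactly $2d+6$ counters, exactly $d$ of which are safe; and, whenever $n\ge 1$, both the running time of the algorithm and the size of its output are at most $C\cdot n\,d\,4^n$. -/

import Mathlib

/-! ### Fast growing functions -/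

/-- `F_0(n) = n + 1` and `F_{d+1}(n) = F_d^{n+1}(n)`. -/
def fastF : ℕ → ℕ → ℕ
  | 0, n => n + 1
  | d + 1, n => (fastF d)^[n + 1] n

/-! ### Counter programs -/

/-- Counters are named by natural numbers; a configuration has finite support. -/
abbrev Config := ℕ →₀ ℕ

/-- General counter programs: increment, decrement and zero-test commands, loops, series
compositions and non-deterministic choices. -/
inductive Program where
  | inc (c : ℕ)
  | dec (c : ℕ)
  | test (c : ℕ)
  | loop (M : Program)
  | seq (M₁ M₂ : Program)
  | or (M₁ M₂ : Program)

namespace Program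

/-- The relation `α --M--> β` on configurations. -/
def Run : Program → Config → Config → Prop
  | inc c => fun α β => (∀ z, z ≠ c → α z = β z) ∧ β c = α c + 1
  | dec c => fun α β => (∀ z, z ≠ c → α z = β z) ∧ β c + 1 = α c
  | test c => fun α β => (∀ z, z ≠ c → α z = β z) ∧ β c = 0 ∧ α c = 0
  | loop M => Relation.ReflTransGen (Run M)
  | seq M₁ M₂ => fun α β => ∃ ρ, Run M₁ α ρ ∧ Run M₂ ρ β
  | or M₁ M₂ => fun α β => Run M₁ α β ∨ Run M₂ α β

/-- The size of a program. -/
def size : Program → ℕ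
  | inc _ => 1
  | dec _ => 1
  | test _ => 1
  | loop M => 1 + M.size
  | seq M₁ M₂ => 1 + M₁.size + M₂.size
  | or M₁ M₂ => 1 + M₁.size + M₂.size

/-- The set of counters used by a program. -/
def counters : Program → Finset ℕ
  | inc c => {c}
  | dec c => {c}
  | test c => {c}
  | loop M => M.counters
  | seq M₁ M₂ => M₁.counters ∪ M₂.counters
  | or M₁ M₂ => M₁.counters ∪ M₂.counters

/-- The set of counters that occur in a test command of a program. -/
def tested : Program → Finset ℕ
  | inc _ => ∅
  | dec _ => ∅
  | test c => {c}
  | loop M => M.tested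
  | seq M₁ M₂ => M₁.tested ∪ M₂.tested
  | or M₁ M₂ => M₁.tested ∪ M₂.tested

/-- The number of counters used by a program. -/
def dimension (M : Program) : ℕ := M.counters.card

/-- No test command occurs in the program. -/
def TestFree : Program → Prop
  | inc _ => True
  | dec _ => True
  | test _ => False
  | loop M => M.TestFree
  | seq M₁ M₂ => M₁.TestFree ∧ M₂.TestFree
  | or M₁ M₂ => M₁.TestFree ∧ M₂.TestFree

/-- The program `test c; test c₁; …; test cₖ`. -/
def tests (c : ℕ) : List ℕ → Program
  | [] => test c
  | c' :: cs => seq (test c) (tests c' cs)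

/-- The program `M; test c₁, …, cₖ`; it is `M` itself if there is no counter to test. -/
def withTests (M : Program) : List ℕ → Program
  | [] => M
  | c :: cs => seq M (tests c cs)

/-- Checking programs: test-free programs followed by final tests. -/
def IsChecking (A : Program) : Prop :=
  ∃ (M : Program) (cs : List ℕ), M.TestFree ∧ A = withTests M cs

/-- `A` is a `K`-preamplifier for the triple of (pairwise distinct) counters `(x, y, b)`. -/
structure IsPreamplifier (K : ℕ) (A : Program) (x y b : ℕ) : Prop where
  x_ne_y : x ≠ y
  x_ne_b : x ≠ b
  y_ne_b : y ≠ b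
  checking : A.IsChecking
  sound : ∀ β : Config, A.Run 0 β →
    β b * β x ≤ β y ∧ (∀ c, c ≠ x → c ≠ y → c ≠ b → β c = 0) ∧
      (β y = β b * β x → β b = K)
  complete : ∀ l : ℕ, 1 ≤ l → ∃ β : Config, A.Run 0 β ∧ β y = β b * β x ∧ β x = l

/-- The safe counters of a preamplifier `A` for `(x, y, b)`: those used by `A`, distinct from
`x`, `y`, `b`, and not tested at the end of `A`. -/
def safe (A : Program) (x y b : ℕ) : Finset ℕ :=
  A.counters \ ({x, y, b} ∪ A.tested)

/-- Prefix notation of a program, as a word of numbers. -/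
def encode : Program → List ℕ
  | inc c => [0, c]
  | dec c => [1, c]
  | test c => [2, c]
  | loop M => 3 :: M.encode
  | seq M₁ M₂ => 4 :: (M₁.encode ++ M₂.encode)
  | or M₁ M₂ => 5 :: (M₁.encode ++ M₂.encode)

end Program

/-! ### Random access machines with unit cost -/

/-- Random access machine programs, with structured control flow. The memory consists of
registers indexed by natural numbers and holding natural numbers; the output is write-only. -/
inductive Ram where
  /-- `R[i] := k` -/
  | const (i k : ℕ)
  /-- `R[i] := R[j] + R[k]` -/
  | add (i j k : ℕ)
  /-- `R[i] := R[j] - R[k]` (truncated) -/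
  | sub (i j k : ℕ)
  /-- `R[i] := R[R[j]]` -/
  | load (i j : ℕ)
  /-- `R[R[i]] := R[j]` -/
  | store (i j : ℕ)
  /-- append `R[i]` to the output -/
  | write (i : ℕ)
  | seq (P Q : Ram)
  /-- if `R[i] ≠ 0` then `P` else `Q` -/
  | ite (i : ℕ) (P Q : Ram)
  /-- while `R[i] ≠ 0` do `P` -/
  | while (i : ℕ) (P : Ram)

namespace Ram

/-- Memory and output of a machine. -/
structure State where
  mem : ℕ → ℕ
  out : List ℕ

/-- Assign the value `v` to register `i`. -/
def State.set (σ : State) (i v : ℕ) : State :=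
  ⟨Function.update σ.mem i v, σ.out⟩

/-- `Exec P σ t τ`: started in state `σ`, the program `P` halts in state `τ` after exactly `t`
steps. Every basic instruction and every evaluation of a condition is one step. -/
inductive Exec : Ram → State → ℕ → State → Prop where
  | const (i k : ℕ) (σ : State) : Exec (.const i k) σ 1 (σ.set i k)
  | add (i j k : ℕ) (σ : State) : Exec (.add i j k) σ 1 (σ.set i (σ.mem j + σ.mem k))
  | sub (i j k : ℕ) (σ : State) : Exec (.sub i j k) σ 1 (σ.set i (σ.mem j - σ.mem k))
  | load (i j : ℕ) (σ : State) : Exec (.load i j) σ 1 (σ.set i (σ.mem (σ.mem j)))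
  | store (i j : ℕ) (σ : State) : Exec (.store i j) σ 1 (σ.set (σ.mem i) (σ.mem j))
  | write (i : ℕ) (σ : State) : Exec (.write i) σ 1 ⟨σ.mem, σ.out ++ [σ.mem i]⟩
  | seq {P Q : Ram} {σ ρ τ : State} {t u : ℕ} :
      Exec P σ t ρ → Exec Q ρ u τ → Exec (.seq P Q) σ (t + u) τ
  | ite_true {i : ℕ} {P Q : Ram} {σ τ : State} {t : ℕ} :
      σ.mem i ≠ 0 → Exec P σ t τ → Exec (.ite i P Q) σ (t + 1) τ
  | ite_false {i : ℕ} {P Q : Ram} {σ τ : State} {t : ℕ} :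
      σ.mem i = 0 → Exec Q σ t τ → Exec (.ite i P Q) σ (t + 1) τ
  | while_true {i : ℕ} {P : Ram} {σ ρ τ : State} {t u : ℕ} :
      σ.mem i ≠ 0 → Exec P σ t ρ → Exec (.while i P) ρ u τ →
        Exec (.while i P) σ (t + u + 1) τ
  | while_false {i : ℕ} {P : Ram} {σ : State} :
      σ.mem i = 0 → Exec (.while i P) σ 1 σ

/-- The initial state on input `(d, n)`: `R[0] = d`, `R[1] = n`, all other registers are zero,
and the output is empty. -/
def initial (d n : ℕ) : State :=
  ⟨fun i => if i = 0 then d else if i = 1 then n else 0, []⟩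

/-- On input `(d, n)`, the machine `P` halts after exactly `t` steps with output `w`. -/
def Outputs (P : Ram) (d n t : ℕ) (w : List ℕ) : Prop :=
  ∃ τ : State, Exec P (initial d n) t τ ∧ τ.out = w

end Ram

/-!
A loop without tests may stop early, so a program cannot be forced to complete its transfers; it can
only be made to pay for them. Every basic step moves the content of the working counters and takes
one unit of a budget for each unit moved, while it multiplies what it moves by `μ`. Hence the
potential `balance`, the budget minus the cost of `R` complete passes through the working counters,
does not decrease when a step reduces `R` by one, and it stays the same only if that step transfers
everything. If initially exactly `R` passes are funded and in the end the budget is tested to be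
zero, then all `R` passes were complete, and this determines the ratios between the counters. The
exponent `v` is stored as the ratio `4 ^ v - 1` of the counters `y` and `x` besides being the
content of a counter of its own.

An amplifier of level `i` replaces the exponent `v` by `fastF (i + 1) v`. It applies `v + 1` times
the amplifier of level `i - 1`, whose budget is in turn filled by the first step of that amplifier,
so that a single test of the highest budget together with tests of the lower ones controls
everything; the counters that control the loops need no test, which makes them safe. The final part
replaces the exponent by a power of two, doubling the ratio of two counters along with it, and
compares the two.

The machine writes the program down level by level. The numbers in it are linear in `n * 4 ^ n`:
they come from the initial ratio `4 ^ n - 1` and, on the lowest level, from `fastF 2 n` itself.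
-/

theorem fastF_zero_iterate (m n : ℕ) : (fastF 0)^[m] n = n + m := by
  induction m with
  | zero => rfl
  | succ m ih => rw [Function.iterate_succ_apply', ih]; rfl

theorem fastF_one (n : ℕ) : fastF 1 n = 2 * n + 1 := by
  rw [fastF, fastF_zero_iterate]
  ring

theorem fastF_one_iterate (m n : ℕ) : (fastF 1)^[m] n + 1 = 2 ^ m * (n + 1) := by
  induction m with
  | zero => rw [Function.iterate_zero_apply, pow_zero, one_mul]
  | succ m ih =>
    rw [Function.iterate_succ_apply', fastF_one, pow_succ']
    linarith

theorem fastF_two (n : ℕ) : fastF 2 n + 1 = 2 ^ (n + 1) * (n + 1) := fastF_one_iterate (n + 1) n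

theorem fastF_two_le {n : ℕ} (hn : 1 ≤ n) : fastF 2 n ≤ 4 * (n * 4 ^ n) :=
  calc fastF 2 n ≤ 2 ^ (n + 1) * (n + 1) := (Nat.le_succ _).trans (fastF_two n).le
    _ ≤ 2 * 4 ^ n * (2 * n) := by
      rw [pow_succ']
      gcongr
      · norm_num
      · omega
    _ = 4 * (n * 4 ^ n) := by ring

namespace Program

open Finsupp

/-! ### Runs as equations between configurations -/

theorem eq_add_single_iff {c m : ℕ} {α β : Config} :
    β = α + single c m ↔ (∀ z, z ≠ c → α z = β z) ∧ β c = α c + m := by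
  constructor
  · rintro rfl
    simp +contextual [eq_comm]
  · rintro ⟨hne, hc⟩
    ext z
    by_cases hz : z = c
    · simp [hz, hc]
    · simp [hne z hz, Ne.symm hz]

theorem run_inc {c : ℕ} {α β : Config} : (inc c).Run α β ↔ β = α + single c 1 :=
  eq_add_single_iff.symm

theorem run_dec {c : ℕ} {α β : Config} : (dec c).Run α β ↔ α = β + single c 1 := by
  simp only [eq_add_single_iff, Run, eq_comm]

theorem run_test {c : ℕ} {α β : Config} : (test c).Run α β ↔ β = α ∧ α c = 0 := by
  constructor
  · rintro ⟨hne, hβ, hα⟩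
    have : β = α + single c 0 := eq_add_single_iff.2 ⟨hne, by rw [hα, hβ]⟩
    simpa [hα] using this
  · rintro ⟨rfl, h⟩
    exact ⟨fun _ _ => rfl, h, h⟩

theorem run_seq {M N : Program} {α β : Config} :
    (seq M N).Run α β ↔ ∃ ρ, M.Run α ρ ∧ N.Run ρ β := Iff.rfl

theorem run_loop {M : Program} {α β : Config} :
    (loop M).Run α β ↔ Relation.ReflTransGen M.Run α β := Iff.rfl

theorem loop_run_self (M : Program) (α : Config) : (loop M).Run α α :=
  Relation.ReflTransGen.refl

theorem Run.loop_induction {M : Program} {α β : Config} (h : (loop M).Run α β)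
    {I : Config → Prop} (init : I α) (body : ∀ ρ τ, M.Run ρ τ → I ρ → I τ) : I β := by
  rw [run_loop] at h
  induction h with
  | refl => exact init
  | tail _ hM ih => exact body _ _ hM ih

theorem Run.frame {M : Program} {α β : Config} (h : M.Run α β) {z : ℕ} (hz : z ∉ M.counters) :
    β z = α z := by
  induction M generalizing α β with
  | inc c => exact (h.1 z (by simpa [counters] using hz)).symm
  | dec c => exact (h.1 z (by simpa [counters] using hz)).symm
  | test c => exact (h.1 z (by simpa [counters] using hz)).symm
  | loop M ih =>
    exact h.loop_induction (I := fun ρ => ρ z = α z) rfl fun ρ τ hM e => (ih hM hz).trans e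
  | seq M N ihM ihN =>
    obtain ⟨ρ, hM, hN⟩ := h
    simp only [counters, Finset.mem_union, not_or] at hz
    rw [ihN hN hz.2, ihM hM hz.1]
  | or M N ihM ihN =>
    simp only [counters, Finset.mem_union, not_or] at hz
    exact h.elim (ihM · hz.1) (ihN · hz.2)

theorem Run.add_right {M : Program} (hM : M.TestFree) {α β : Config} (h : M.Run α β)
    (γ : Config) : M.Run (α + γ) (β + γ) := by
  induction M generalizing α β with
  | inc c => rw [run_inc] at h ⊢; rw [h, add_right_comm]
  | dec c => rw [run_dec] at h ⊢; rw [h, add_right_comm]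
  | test c => exact hM.elim
  | loop M ih =>
    exact h.loop_induction (I := fun ρ => (loop M).Run (α + γ) (ρ + γ)) .refl
      fun ρ τ hMr hρ => hρ.tail (ih hM hMr)
  | seq M N ihM ihN =>
    obtain ⟨ρ, h1, h2⟩ := h
    exact ⟨ρ + γ, ihM hM.1 h1, ihN hM.2 h2⟩
  | or M N ihM ihN => exact h.imp (ihM hM.1) (ihN hM.2)

theorem Run.of_eq_add {M : Program} (hM : M.TestFree) {u w : Config} (h : M.Run u w)
    (γ : Config) {α β : Config} (hα : α = u + γ) (hβ : β = w + γ) : M.Run α β := by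
  subst hα hβ
  exact h.add_right hM γ

/-- `m` increments of `c`, followed by `P`. -/
def incs (c : ℕ) : ℕ → Program → Program
  | 0, P => P
  | m + 1, P => seq (inc c) (incs c m P)

/-- `m` decrements of `c`, followed by `P`. -/
def decs (c : ℕ) : ℕ → Program → Program
  | 0, P => P
  | m + 1, P => seq (dec c) (decs c m P)

theorem run_incs {c m : ℕ} {P : Program} {α β : Config} :
    (incs c m P).Run α β ↔ P.Run (α + single c m) β := by
  induction m generalizing α with
  | zero => simp [incs]
  | succ m ih =>
    simp only [incs, run_seq, run_inc, exists_eq_left, ih]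
    rw [add_assoc, ← single_add, add_comm 1 m]

theorem run_decs {c m : ℕ} {P : Program} {α β : Config} :
    (decs c m P).Run α β ↔ ∃ ρ, α = ρ + single c m ∧ P.Run ρ β := by
  induction m generalizing α with
  | zero => simp [decs]
  | succ m ih =>
    simp only [decs, run_seq, run_dec, ih, single_add, ← add_assoc]
    constructor
    · rintro ⟨_, rfl, ρ, rfl, h⟩
      exact ⟨ρ, rfl, h⟩
    · rintro ⟨ρ, rfl, h⟩
      exact ⟨ρ + single c m, rfl, ρ, rfl, h⟩

/-- `M` replaces a part `u` of the configuration by `w`. -/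
def Replaces (M : Program) (u w : Config) : Prop :=
  ∀ α β, M.Run α β ↔ ∃ γ, α = γ + u ∧ β = γ + w

theorem Replaces.run {M : Program} {u w : Config} (h : M.Replaces u w) (γ : Config) :
    M.Run (γ + u) (γ + w) := (h _ _).2 ⟨γ, rfl, rfl⟩

theorem Replaces.loop_run {M : Program} {u w : Config} (h : M.Replaces u w) (i : ℕ) (γ : Config) :
    (loop M).Run (γ + i • u) (γ + i • w) := by
  induction i generalizing γ with
  | zero => simpa using loop_run_self M γ
  | succ i ih =>
    have head : M.Run (γ + (i + 1) • u) (γ + w + i • u) := by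
      convert h.run (γ + i • u) using 1
      · rw [succ_nsmul, add_assoc]
      · rw [add_right_comm]
    rw [succ_nsmul' w, ← add_assoc]
    exact Relation.ReflTransGen.head head (ih (γ + w))

theorem Replaces.exists_nsmul_of_loop {M : Program} {u w : Config} (h : M.Replaces u w)
    {α β : Config} (hr : (loop M).Run α β) : ∃ i : ℕ, β + i • u = α + i • w := by
  refine hr.loop_induction (I := fun β => ∃ i : ℕ, β + i • u = α + i • w) ⟨0, by simp⟩ ?_
  rintro _ _ hM ⟨i, hi⟩
  obtain ⟨γ, rfl, rfl⟩ := (h _ _).1 hM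
  refine ⟨i + 1, ?_⟩
  rw [succ_nsmul, succ_nsmul, ← add_assoc α, ← hi]
  abel

theorem replaces_inc (c : ℕ) : (inc c).Replaces 0 (single c 1) := by
  intro α β
  simp [run_inc]

theorem Replaces.incs {P : Program} {w : Config} (h : P.Replaces 0 w) (c m : ℕ) :
    (incs c m P).Replaces 0 (single c m + w) := by
  intro α β
  rw [run_incs, h]
  simp [add_assoc]

theorem Replaces.decs {P : Program} {u w : Config} (h : P.Replaces u w) (c m : ℕ) :
    (decs c m P).Replaces (u + single c m) w := by
  intro α β
  rw [run_decs]
  constructor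
  · rintro ⟨ρ, rfl, hr⟩
    obtain ⟨γ, rfl, rfl⟩ := (h _ _).1 hr
    exact ⟨γ, add_assoc _ _ _, rfl⟩
  · rintro ⟨γ, rfl, rfl⟩
    exact ⟨γ + u, (add_assoc _ _ _).symm, h.run γ⟩

theorem Replaces.dec_seq {P : Program} {u w : Config} (h : P.Replaces u w) (c : ℕ) :
    (seq (dec c) P).Replaces (u + single c 1) w := h.decs c 1

@[simp]
theorem testFree_incs (c m : ℕ) (P : Program) : (incs c m P).TestFree ↔ P.TestFree := by
  induction m with
  | zero => rfl
  | succ m ih => simp [incs, TestFree, ih]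

@[simp]
theorem testFree_decs (c m : ℕ) (P : Program) : (decs c m P).TestFree ↔ P.TestFree := by
  induction m with
  | zero => rfl
  | succ m ih => simp [decs, TestFree, ih]

theorem counters_incs (c m : ℕ) (P : Program) :
    (incs c m P).counters = if m = 0 then P.counters else insert c P.counters := by
  induction m with
  | zero => rfl
  | succ m ih =>
    rw [incs, counters, counters, ih, if_neg (Nat.succ_ne_zero m)]
    split_ifs <;> ext z <;> simp

theorem counters_decs (c m : ℕ) (P : Program) :
    (decs c m P).counters = if m = 0 then P.counters else insert c P.counters := by
  induction m with
  | zero => rfl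
  | succ m ih =>
    rw [decs, counters, counters, ih, if_neg (Nat.succ_ne_zero m)]
    split_ifs <;> ext z <;> simp

theorem loop_dec_run {M : Program} (hM : M.TestFree) (c : ℕ) {s : ℕ → Config} {q : ℕ}
    (h : ∀ j < q, M.Run (s j) (s (j + 1))) :
    (loop (seq (dec c) M)).Run (s 0 + single c q) (s q) := by
  induction q with
  | zero => simpa using loop_run_self (seq (dec c) M) (s 0)
  | succ q ih =>
    have init : (loop (seq (dec c) M)).Run (s 0 + single c (q + 1)) (s q + single c 1) := by
      rw [single_add, ← add_assoc]
      exact (ih fun j hj => h j (by omega)).add_right (M := loop (seq (dec c) M)) ⟨trivial, hM⟩ _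
    exact .tail init ⟨s q, run_dec.2 rfl, h q q.lt_succ_self⟩

/-! ### The basic step -/

/-- Transfer from `c` to `c'`. -/
def move (c c' : ℕ) : Program := loop (seq (dec c) (inc c'))

/-- Transfer from `c` to `c'`, multiplied by `μ` and paid for by `o`. -/
def paidMove (μ o c c' : ℕ) : Program :=
  loop (seq (dec c) (seq (dec o) (incs c' (μ - 1) (inc c'))))

/-- Remove `a * i` units from `x` for some `i`, put `i` of them into `x'` and the others into `y'`,
and transfer from `y` to `y'`. -/
def divide (a x y x' y' : ℕ) : Program :=
  seq (loop (decs x a (incs y' (a - 1) (inc x')))) (move y y')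

/-- Transfer from `x'` to `x` and from `y'` to `t`, multiplied by `μ` and paid for by `o`. -/
def payBack (μ o x' y' x t : ℕ) : Program :=
  seq (paidMove μ o x' x) (paidMove μ o y' t)

/-- The basic step of all amplifiers: `divide`, then `payBack`. A *pass* is a run of `payBack` that
transfers everything, and so costs as much as the total content of the counters. -/
def step (a μ x y x' y' o t : ℕ) : Program :=
  seq (divide a x y x' y') (payBack μ o x' y' x t)

theorem run_move {c c' : ℕ} {α β : Config} (h : (move c c').Run α β) :
    ∃ i, β + single c i = α + single c' i := by
  obtain ⟨i, hi⟩ := ((replaces_inc c').dec_seq c).exists_nsmul_of_loop h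
  exact ⟨i, by simpa using hi⟩

theorem move_run (c c' i : ℕ) (γ : Config) :
    (move c c').Run (γ + single c i) (γ + single c' i) := by
  simpa [move] using ((replaces_inc c').dec_seq c).loop_run i γ

theorem replaces_paidMove_body {μ : ℕ} (hμ : 1 ≤ μ) (o c c' : ℕ) :
    (seq (dec c) (seq (dec o) (incs c' (μ - 1) (inc c')))).Replaces
      (single o 1 + single c 1) (single c' μ) := by
  have h := (((replaces_inc c').incs c' (μ - 1)).dec_seq o).dec_seq c
  rwa [← single_add, Nat.sub_add_cancel hμ, zero_add] at h

theorem run_paidMove {μ o c c' : ℕ} (hμ : 1 ≤ μ) {α β : Config} (h : (paidMove μ o c c').Run α β) :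
    ∃ i, β + single o i + single c i = α + single c' (μ * i) := by
  obtain ⟨i, hi⟩ := (replaces_paidMove_body hμ o c c').exists_nsmul_of_loop h
  exact ⟨i, by simpa [add_assoc, mul_comm] using hi⟩

theorem paidMove_run {μ : ℕ} (hμ : 1 ≤ μ) (o c c' i : ℕ) (γ : Config) :
    (paidMove μ o c c').Run (γ + single o i + single c i) (γ + single c' (μ * i)) := by
  simpa [paidMove, add_assoc, mul_comm] using (replaces_paidMove_body hμ o c c').loop_run i γ

theorem replaces_divide_body (a x x' y' : ℕ) :
    (decs x a (incs y' (a - 1) (inc x'))).Replaces (single x a)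
      (single y' (a - 1) + single x' 1) := by
  simpa using ((replaces_inc x').incs y' (a - 1)).decs x a

theorem run_divide {a x y x' y' : ℕ} {α β : Config} (h : (divide a x y x' y').Run α β) :
    ∃ i m, β + single x (a * i) + single y m = α + single x' i + single y' (m + (a - 1) * i) := by
  obtain ⟨ρ, hdiv, hmove⟩ := h
  obtain ⟨i, hi⟩ := (replaces_divide_body a x x' y').exists_nsmul_of_loop hdiv
  obtain ⟨m, hm⟩ := run_move hmove
  refine ⟨i, m, ?_⟩
  simp only [smul_add, smul_single, smul_eq_mul, mul_one] at hi
  rw [add_right_comm, hm, add_right_comm, mul_comm a, hi, mul_comm (a - 1), single_add]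
  abel

theorem divide_run (a x y x' y' i m : ℕ) (γ : Config) :
    (divide a x y x' y').Run (γ + single x (a * i) + single y m)
      (γ + single x' i + single y' (m + (a - 1) * i)) := by
  have hdiv := (replaces_divide_body a x x' y').loop_run i (γ + single y m)
  have hmove := move_run y y' m (γ + single x' i + single y' ((a - 1) * i))
  simp only [smul_add, smul_single, smul_eq_mul, mul_comm i, one_mul] at hdiv
  refine ⟨γ + single x' i + single y' ((a - 1) * i) + single y m, ?_, ?_⟩
  · convert hdiv using 1 <;> abel
  · convert hmove using 1
    rw [single_add]; abel

theorem run_payBack {μ o x' y' x t : ℕ} (hμ : 1 ≤ μ) {α β : Config}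
    (h : (payBack μ o x' y' x t).Run α β) :
    ∃ p q, β + single o (p + q) + single x' p + single y' q =
      α + single x (μ * p) + single t (μ * q) := by
  obtain ⟨ρ, hp, hq⟩ := h
  obtain ⟨p, hp⟩ := run_paidMove hμ hp
  obtain ⟨q, hq⟩ := run_paidMove hμ hq
  refine ⟨p, q, ?_⟩
  rw [← hp, add_right_comm _ _ (single t _), add_right_comm _ _ (single t _), ← hq, single_add]
  abel

theorem payBack_run {μ : ℕ} (hμ : 1 ≤ μ) (o x' y' x t p q : ℕ) (γ : Config) :
    (payBack μ o x' y' x t).Run (γ + single o (p + q) + single x' p + single y' q)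
      (γ + single x (μ * p) + single t (μ * q)) := by
  have toX := paidMove_run hμ o x' x p (γ + single o q + single y' q)
  have toT := paidMove_run hμ o y' t q (γ + single x (μ * p))
  refine ⟨γ + single x (μ * p) + single o q + single y' q, ?_, toT⟩
  convert toX using 1
  · rw [single_add]; abel
  · abel

theorem step_run {μ : ℕ} (hμ : 1 ≤ μ) (a x y x' y' o t i m : ℕ) (γ : Config) :
    (step a μ x y x' y' o t).Run
      (γ + single o (i + (m + (a - 1) * i)) + single x (a * i) + single y m)
      (γ + single x (μ * i) + single t (μ * (m + (a - 1) * i))) :=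
  ⟨_, divide_run .., payBack_run hμ ..⟩

@[simp]
theorem testFree_step (a μ x y x' y' o t : ℕ) : (step a μ x y x' y' o t).TestFree := by
  simp [step, divide, payBack, move, paidMove, TestFree]

theorem counters_step {a : ℕ} (ha : 1 ≤ a) (μ x y x' y' o t : ℕ) :
    (step a μ x y x' y' o t).counters = {x, y, x', y', o, t} := by
  simp only [step, divide, payBack, move, paidMove, counters, counters_decs, counters_incs]
  split_ifs <;> first
    | omega
    | ext z
      simp only [Finset.mem_union, Finset.mem_insert, Finset.mem_singleton]
      tauto

/-- The total content of a set of counters. -/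
def total (Z : Finset ℕ) (α : Config) : ℕ := ∑ z ∈ Z, α z

@[simp]
theorem total_add (Z : Finset ℕ) (α β : Config) : total Z (α + β) = total Z α + total Z β := by
  simp [total, Finset.sum_add_distrib]

@[simp]
theorem total_single (Z : Finset ℕ) (c m : ℕ) :
    total Z (single c m) = if c ∈ Z then m else 0 := by
  simp [total, single_apply]

theorem le_total {Z : Finset ℕ} {z : ℕ} (hz : z ∈ Z) (α : Config) : α z ≤ total Z α :=
  Finset.single_le_sum (f := fun z => α z) (fun _ _ => Nat.zero_le _) hz

theorem total_erase_add {Z : Finset ℕ} {z : ℕ} (hz : z ∈ Z) (α : Config) :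
    total (Z.erase z) α + α z = total Z α :=
  Finset.sum_erase_add _ _ hz

/-- The counters of a basic step: four distinct working counters and a target in `Z`, and a budget
outside `Z`. The target may be the counter `y`. -/
structure StepCounters (Z : Finset ℕ) (x y x' y' o t : ℕ) : Prop where
  nodup : [x, y, x', y'].Nodup
  mem : ∀ c ∈ [x, y, x', y', t], c ∈ Z
  budget : o ∉ Z
  target : t ∉ [x, x', y']

/-- The effect on the counters of `Z` of a basic step in which `payBack` is a pass. -/
structure IsPass (Z : Finset ℕ) (a μ x y x' y' o t : ℕ) (α β : Config) : Prop where
  frame : ∀ z, z ∉ ({x, y, x', y', o, t} : Finset ℕ) → β z = α z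
  eq_zero_of_ne : ∀ z ∈ Z, z ∉ [x, y, x', y'] → α z = 0
  divided : α x' = 0 → α y' = 0 →
    ∃ i, α x = a * i ∧ β x = μ * i ∧ β t = μ * (α y + (a - 1) * i)
  eq_zero : ∀ z ∈ Z, z ≠ x → z ≠ t → β z = 0

section Step

variable {Z : Finset ℕ} {a μ x y x' y' o t : ℕ}

theorem StepCounters.ne (hZ : StepCounters Z x y x' y' o t) :
    ∀ c ∈ [x, y, x', y', t], c ≠ o :=
  fun c hc h => hZ.budget (h ▸ hZ.mem c hc)

theorem StepCounters.divide_sound (hZ : StepCounters Z x y x' y' o t) (ha : 1 ≤ a) {α ρ : Config}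
    (h : (divide a x y x' y').Run α ρ) :
    ρ o = α o ∧ total Z ρ = total Z α ∧
      ((∀ z ∈ Z, z ∉ [x', y'] → ρ z = 0) →
        (∀ z ∈ Z, z ∉ [x, y, x', y'] → α z = 0) ∧
        (α x' = 0 → α y' = 0 → α x = a * ρ x' ∧ ρ y' = α y + (a - 1) * ρ x')) := by
  obtain ⟨i, m, e⟩ := run_divide h
  have e_apply (z : ℕ) := DFunLike.congr_fun e z
  simp only [Finsupp.add_apply, single_apply] at e_apply
  have hnodup := hZ.nodup
  have hmem := hZ.mem
  have hne := hZ.ne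
  simp only [List.nodup_cons, List.mem_cons, List.not_mem_nil, or_false, forall_eq_or_imp,
    forall_eq] at hnodup hmem hne
  have e_total := congrArg (total Z) e
  obtain ⟨a, rfl⟩ := Nat.exists_eq_add_of_le' ha
  simp only [total_add, total_single, hmem, if_true, add_tsub_cancel_right, add_mul,
    one_mul] at e_total e_apply ⊢
  refine ⟨by grind, by omega, fun h0 => ⟨fun z hz hne => ?_, fun hx' hy' => ?_⟩⟩
  · grind
  · have := h0 x
    have := h0 y
    grind

theorem StepCounters.payBack_sound (hZ : StepCounters Z x y x' y' o t) (hμ : 1 ≤ μ) {ρ β : Config}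
    (h : (payBack μ o x' y' x t).Run ρ β) :
    ∃ e, β o + e = ρ o ∧ total Z β + e = total Z ρ + μ * e ∧ e ≤ total Z ρ ∧
      (e = total Z ρ → (∀ z ∈ Z, z ∉ [x', y'] → ρ z = 0) ∧ β x = μ * ρ x' ∧ β t = μ * ρ y' ∧
        ∀ z ∈ Z, z ≠ x → z ≠ t → β z = 0) := by
  obtain ⟨p, q, e⟩ := run_payBack hμ h
  have e_apply (z : ℕ) := DFunLike.congr_fun e z
  simp only [Finsupp.add_apply, single_apply] at e_apply
  have hnodup := hZ.nodup
  have hmem := hZ.mem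
  have hne := hZ.ne
  have htarget := hZ.target
  have hbudget := hZ.budget
  simp only [List.nodup_cons, List.mem_cons, List.not_mem_nil, or_false, forall_eq_or_imp,
    forall_eq, not_or] at hnodup hmem hne htarget
  have e_total := congrArg (total Z) e
  simp only [total_add, total_single, hmem, hbudget, if_true, if_false] at e_total
  have hx' := total_erase_add hmem.2.2.1 ρ
  have hy' := total_erase_add (show y' ∈ Z.erase x' by grind) ρ
  have hp : p ≤ ρ x' := by grind
  have hq : q ≤ ρ y' := by grind
  refine ⟨p + q, by grind, by rw [mul_add]; omega, by omega, fun he => ?_⟩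
  have hzero : ∀ z ∈ Z, z ∉ [x', y'] → ρ z = 0 := fun z hz hne => by
    have := le_total (Z := (Z.erase x').erase y') (z := z) (by grind) ρ
    omega
  have hpx' : p = ρ x' := by omega
  have hqy' : q = ρ y' := by omega
  have hx0 := hzero x
  have ht0 := hzero t
  refine ⟨hzero, by grind, by grind, fun z hz hzx hzt => ?_⟩
  have := hzero z hz
  have := e_apply z
  grind

theorem StepCounters.step_sound (hZ : StepCounters Z x y x' y' o t) (ha : 1 ≤ a) (hμ : 1 ≤ μ)
    {α β : Config} (h : (step a μ x y x' y' o t).Run α β) :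
    ∃ e, β o + e = α o ∧ total Z β + e = total Z α + μ * e ∧ e ≤ total Z α ∧
      (e = total Z α → IsPass Z a μ x y x' y' o t α β) := by
  obtain ⟨ρ, hdiv, hpay⟩ := id h
  obtain ⟨hρo, hρ, hdivided⟩ := hZ.divide_sound ha hdiv
  obtain ⟨e, hβo, hβ, he, hpass⟩ := hZ.payBack_sound hμ hpay
  rw [hρ] at hβ he hpass
  refine ⟨e, hβo.trans hρo, hβ, he, fun heq => ?_⟩
  obtain ⟨hρ0, hβx, hβt, hβ0⟩ := hpass heq
  obtain ⟨hα0, hα⟩ := hdivided hρ0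
  refine ⟨fun z hz => h.frame (by rwa [counters_step ha]), hα0, fun hx' hy' => ?_, hβ0⟩
  obtain ⟨hx, hy⟩ := hα hx' hy'
  exact ⟨ρ x', hx, hβx, by rw [hβt, hy]⟩

end Step

/-! ### Potentials -/

/-- The balance of the budget `o` with respect to `R` passes through the counters of `Z`, each of
which multiplies their content by `μ`. -/
def balance (μ : ℕ) (Z : Finset ℕ) (o R : ℕ) (α : Config) : ℤ :=
  α o - (∑ i ∈ Finset.range R, (μ : ℤ) ^ i) * total Z α

/-- Between `α` and `β` at most `k` passes are paid for, as measured by the potentials `Φ R`, and if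
exactly `k` passes are paid for then `P α` implies `Q β`. -/
def Paid (Φ : ℕ → Config → ℤ) (k : ℕ) (P Q : Config → Prop) (α β : Config) : Prop :=
  ∀ R, Φ (R + k) α ≤ Φ R β ∧ (Φ (R + k) α = Φ R β → P α → Q β)

/-- A Hoare triple with a cost: `Paid` holds for every run of `M`. -/
def Pays (Φ : ℕ → Config → ℤ) (k : ℕ) (M : Program) (P Q : Config → Prop) : Prop :=
  ∀ α β, M.Run α β → Paid Φ k P Q α β

section Pays

variable {Φ : ℕ → Config → ℤ} {k l c : ℕ} {M N : Program} {P Q S : Config → Prop}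
  {α β ρ : Config}

theorem Paid.trans (hαρ : Paid Φ k P Q α ρ) (hρβ : Paid Φ l Q S ρ β) :
    Paid Φ (l + k) P S α β := by
  intro R
  obtain ⟨le_αρ, eq_αρ⟩ := hαρ (R + l)
  obtain ⟨le_ρβ, eq_ρβ⟩ := hρβ R
  rw [← add_assoc]
  exact ⟨le_αρ.trans le_ρβ, fun h p => eq_ρβ (by omega) (eq_αρ (by omega) p)⟩

theorem Paid.of_eq (hΦ : ∀ R, Φ R β = Φ R α) (h : P α → Q β) : Paid Φ 0 P Q α β :=
  fun R => ⟨(hΦ R).ge, fun _ => h⟩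

theorem Paid.imp (h : Paid Φ k P Q α β) (p : Prop) :
    Paid Φ k (fun σ => p → P σ) (fun σ => p → Q σ) α β :=
  fun R => ⟨(h R).1, fun hR hP hp => (h R).2 hR (hP hp)⟩

theorem Pays.seq (hM : Pays Φ k M P Q) (hN : Pays Φ l N Q S) : Pays Φ (l + k) (M.seq N) P S :=
  fun _ _ ⟨_, h1, h2⟩ => (hM _ _ h1).trans (hN _ _ h2)

theorem Pays.loop_dec {P : ℕ → Config → Prop} (hM : ∀ i, Pays Φ k M (P i) (P (i + 1)))
    (hc : c ∉ M.counters)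
    (hΦ : ∀ α β : Config, (∀ z, z ≠ c → β z = α z) → ∀ R, Φ R β = Φ R α)
    (hP : ∀ i, ∀ α β : Config, (∀ z, z ≠ c → β z = α z) → P i α → P i β)
    (h : (loop (Program.seq (dec c) M)).Run α β) :
    ∃ q, β c + q = α c ∧ Paid Φ (k * q) (P 0) (P q) α β := by
  refine h.loop_induction (I := fun β => ∃ q, β c + q = α c ∧ Paid Φ (k * q) (P 0) (P q) α β)
    ⟨0, rfl, .of_eq (fun _ => rfl) id⟩ ?_
  rintro ρ β ⟨τ, hdec, hbody⟩ ⟨q, hq, ih⟩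
  have hτ : ∀ z, z ≠ c → τ z = ρ z := fun z hz => (hdec.1 z hz).symm
  refine ⟨q + 1, ?_, ?_⟩
  · have := hbody.frame hc
    have := hdec.2
    omega
  · rw [mul_add_one, add_comm (k * q), ← zero_add (k * q)]
    exact (ih.trans (.of_eq (hΦ ρ τ hτ) (hP q ρ τ hτ))).trans (hM q τ β hbody)

end Pays

theorem balance_congr {μ : ℕ} {Z : Finset ℕ} {o : ℕ} {α β : Config} (ho : β o = α o)
    (hZ : total Z β = total Z α) (R : ℕ) : balance μ Z o R β = balance μ Z o R α := by
  rw [balance, balance, ho, hZ]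

theorem balance_pass {μ : ℕ} (hμ : 1 ≤ μ) {Z : Finset ℕ} {o e : ℕ} {α β : Config}
    (ho : β o + e = α o) (hZ : total Z β + e = total Z α + μ * e) (he : e ≤ total Z α) (R : ℕ) :
    balance μ Z o (R + 1) α ≤ balance μ Z o R β ∧
      (balance μ Z o (R + 1) α = balance μ Z o R β → e = total Z α) := by
  have key : balance μ Z o R β - balance μ Z o (R + 1) α = (μ : ℤ) ^ R * (total Z α - e) := by
    have geom : (∑ i ∈ Finset.range R, (μ : ℤ) ^ i) * (μ - 1) = (μ : ℤ) ^ R - 1 := geom_sum_mul _ _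
    simp only [balance, Finset.sum_range_succ]
    zify at ho hZ
    rw [← ho, eq_sub_of_add_eq hZ]
    linear_combination (-(e : ℤ)) * geom
  have hpow : (0 : ℤ) < (μ : ℤ) ^ R := by positivity
  have hdiff : (0 : ℤ) ≤ total Z α - e := by omega
  refine ⟨by nlinarith, fun heq => ?_⟩
  rw [heq, sub_self] at key
  have := (mul_eq_zero.1 key.symm).resolve_left hpow.ne'
  omega

theorem StepCounters.pays {a μ x y x' y' o t : ℕ} {Z : Finset ℕ}
    (hZ : StepCounters Z x y x' y' o t) (ha : 1 ≤ a) (hμ : 1 ≤ μ) {P Q : Config → Prop}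
    (h : ∀ α β, IsPass Z a μ x y x' y' o t α β → P α → Q β) :
    Pays (balance μ Z o) 1 (step a μ x y x' y' o t) P Q := by
  intro α β hr R
  obtain ⟨e, ho, htotal, he, hpass⟩ := hZ.step_sound ha hμ hr
  obtain ⟨hle, heq⟩ := balance_pass hμ ho htotal he R
  exact ⟨hle, fun hb => h α β (hpass (heq hb))⟩

theorem Paid.exact {μ : ℕ} {Z : Finset ℕ} {o k N : ℕ} {P Q : Config → Prop} {α β : Config}
    (h : Paid (balance μ Z o) k P Q α β) (hk : k ≤ N) (hα : balance μ Z o N α = 0) (ho : β o = 0)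
    (hZ : 1 ≤ total Z β) : k = N ∧ (P α → Q β) := by
  obtain ⟨R, rfl⟩ := Nat.exists_eq_add_of_le' hk
  obtain ⟨hle, heq⟩ := h R
  rw [hα] at hle heq
  obtain rfl : R = 0 := by
    by_contra hR
    have hgeom := Finset.single_le_sum (f := fun i => (μ : ℤ) ^ i) (fun i _ => by positivity)
      (Finset.mem_range.2 (Nat.pos_of_ne_zero hR))
    simp only [balance, ho, pow_zero] at hle hgeom
    zify at hZ
    push_cast at hle
    nlinarith
  exact ⟨(zero_add k).symm, heq (by simp [balance, ho])⟩

/-- Runs of `M` do not change the total content of `Z`. -/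
def Conserves (M : Program) (Z : Finset ℕ) : Prop :=
  ∀ α β, M.Run α β → total Z β = total Z α

section Conserves

variable {M N : Program} {Z : Finset ℕ}

theorem total_congr {α β : Config} (h : ∀ z ∈ Z, β z = α z) : total Z β = total Z α :=
  Finset.sum_congr rfl h

theorem conserves_of_disjoint (h : Disjoint M.counters Z) : M.Conserves Z := fun _ _ hr =>
  total_congr fun _ hz => hr.frame (Finset.disjoint_right.1 h hz)

theorem conserves_inc {c : ℕ} (hc : c ∉ Z) : (inc c).Conserves Z :=
  conserves_of_disjoint (Finset.disjoint_singleton_left.2 hc)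

theorem conserves_dec {c : ℕ} (hc : c ∉ Z) : (dec c).Conserves Z :=
  conserves_of_disjoint (Finset.disjoint_singleton_left.2 hc)

theorem Conserves.seq (hM : M.Conserves Z) (hN : N.Conserves Z) : (M.seq N).Conserves Z :=
  fun _ _ ⟨_, h1, h2⟩ => (hN _ _ h2).trans (hM _ _ h1)

theorem Conserves.loop (hM : M.Conserves Z) : (loop M).Conserves Z := fun α _ hr =>
  hr.loop_induction (I := fun β => total Z β = total Z α) rfl fun _ _ h e => (hM _ _ h).trans e

theorem total_insert {o : ℕ} (ho : o ∉ Z) (α : Config) :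
    total (insert o Z) α = total Z α + α o := by
  rw [total, Finset.sum_insert ho, add_comm, total]

theorem Conserves.insert {o : ℕ} (hM : M.Conserves Z) (ho : o ∉ Z) (hoM : o ∉ M.counters) :
    M.Conserves (insert o Z) := fun _ _ hr => by
  rw [total_insert ho, total_insert ho, hM _ _ hr, hr.frame hoM]

theorem StepCounters.conserves {a x y x' y' o t : ℕ} (hZ : StepCounters Z x y x' y' o t)
    (ha : 1 ≤ a) : (step a 2 x y x' y' o t).Conserves (insert o Z) := fun _ _ hr => by
  obtain ⟨e, ho, htotal, -⟩ := hZ.step_sound ha one_le_two hr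
  rw [total_insert hZ.budget, total_insert hZ.budget]
  omega

end Conserves

/-! ### Amplifiers -/

/-- The budget counter of level `i`. In the amplifiers `0`, `1`, `2`, `3` are the counters `x`, `y`,
`x'`, `y'` of the basic step, `4` is the exponent, and the counters from `5` on are alternately
budgets and controls. -/
abbrev budget (i : ℕ) : ℕ := 5 + 2 * i

/-- The control counter of level `i`. That of level `0` also controls loops on higher levels. -/
abbrev control (i : ℕ) : ℕ := 6 + 2 * i

/-- Increment the exponent, paid for by `o`. -/
def incr (o : ℕ) : Program := seq (step 4 2 0 1 2 3 o 1) (inc 4)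

/-- The part of the amplifier of level `i` that follows its first step, paid for by the budget of
level `i`. From the exponent `v` it makes `2 * v + 1` passes: `2 * v + 1` increments of the exponent
on level `0`, and `v` increments and `v + 1` lower amplifiers on the other levels. -/
def ampBody : ℕ → Program
  | 0 => seq (move 4 (control 0))
      (seq (loop (seq (dec (control 0)) (seq (incr (budget 0)) (incr (budget 0)))))
        (incr (budget 0)))
  | i + 1 => seq (loop (seq (dec 4) (seq (inc (control (i + 1))) (inc (control 0)))))
      (seq (inc (control (i + 1)))
        (seq (loop (seq (dec (control 0)) (incr (budget (i + 1)))))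
          (loop (seq (dec (control (i + 1)))
            (seq (step 2 2 0 1 2 3 (budget (i + 1)) (budget i)) (ampBody i))))))

/-- The amplifier of level `i`, which multiplies by `μ` and replaces the exponent `v` by
`fastF (i + 1) v`. -/
def amp (i μ : ℕ) : Program := seq (step 2 μ 0 1 2 3 (budget (i + 1)) (budget i)) (ampBody i)

theorem ampBody_succ (i : ℕ) : ampBody (i + 1) =
    seq (loop (seq (dec 4) (seq (inc (control (i + 1))) (inc (control 0)))))
      (seq (inc (control (i + 1)))
        (seq (loop (seq (dec (control 0)) (incr (budget (i + 1)))))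
          (loop (seq (dec (control (i + 1))) (amp i 2))))) := rfl

theorem counters_incr (o : ℕ) : (incr o).counters = {0, 1, 2, 3, 4, o} := by
  rw [incr, counters, counters_step (by norm_num), counters]
  grind

theorem counters_ampBody (i : ℕ) : (ampBody i).counters = Finset.range (7 + 2 * i) := by
  induction i with
  | zero =>
    simp only [ampBody, move, counters, counters_incr]
    decide
  | succ i ih =>
    simp only [ampBody, counters, counters_incr, ih, counters_step one_le_two]
    ext z
    simp only [Finset.mem_union, Finset.mem_insert, Finset.mem_singleton, Finset.mem_range, budget,
      control]
    omega

theorem counters_amp (i μ : ℕ) : (amp i μ).counters = Finset.range (8 + 2 * i) := by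
  rw [amp, counters, counters_ampBody, counters_step one_le_two]
  ext z
  simp only [Finset.mem_union, Finset.mem_insert, Finset.mem_singleton, Finset.mem_range, budget]
  omega

/-- The counters `x`, `y`, `x'`, `y'` and the budgets below level `i`, whose content the budget of
level `i` pays for. -/
def pool (i : ℕ) : Finset ℕ := {0, 1, 2, 3} ∪ (Finset.range i).image budget

@[grind =]
theorem mem_pool {i z : ℕ} : z ∈ pool i ↔ z ≤ 3 ∨ ∃ k < i, z = budget k := by
  simp only [pool, Finset.mem_union, Finset.mem_insert, Finset.mem_singleton, Finset.mem_image,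
    Finset.mem_range, eq_comm (a := z)]
  exact or_congr (by omega) Iff.rfl

theorem budget_mem_pool {i k : ℕ} (hk : k < i) : budget k ∈ pool i :=
  mem_pool.2 (.inr ⟨k, hk, rfl⟩)

theorem pool_succ (i : ℕ) : pool (i + 1) = insert (budget i) (pool i) := by
  rw [pool, Finset.range_add_one, Finset.image_insert, Finset.union_insert, pool]

theorem stepCounters_incr (i : ℕ) : StepCounters (pool i) 0 1 2 3 (budget i) 1 :=
  ⟨by decide, by grind, by grind, by decide⟩

theorem stepCounters_amp (i : ℕ) :
    StepCounters (pool (i + 1)) 0 1 2 3 (budget (i + 1)) (budget i) :=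
  ⟨by decide, by have := budget_mem_pool i.lt_add_one; grind, by grind, by grind⟩

theorem budget_succ_notMem_ampBody (i : ℕ) : budget (i + 1) ∉ (ampBody i).counters := by
  rw [counters_ampBody, Finset.mem_range, budget]
  omega

theorem conserves_incr (i : ℕ) : (incr (budget i)).Conserves (pool (i + 1)) := by
  rw [incr, pool_succ]
  exact ((stepCounters_incr i).conserves (by norm_num)).seq (conserves_inc (by grind))

theorem conserves_ampBody (i : ℕ) : (ampBody i).Conserves (pool (i + 1)) := by
  induction i with
  | zero =>
    have h4 : 4 ∉ pool 1 := by grind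
    have h6 : control 0 ∉ pool 1 := by grind
    exact ((conserves_dec h4).seq (conserves_inc h6)).loop.seq
      ((((conserves_dec h6).seq ((conserves_incr 0).seq (conserves_incr 0))).loop).seq
        (conserves_incr 0))
  | succ i ih =>
    have h4 : 4 ∉ pool (i + 2) := by grind
    have h6 : control 0 ∉ pool (i + 2) := by grind
    have hc : control (i + 1) ∉ pool (i + 2) := by grind
    have hstep := (stepCounters_amp i).conserves one_le_two
    have hbody := ih.insert (stepCounters_amp i).budget (budget_succ_notMem_ampBody i)
    rw [← pool_succ] at hstep hbody
    exact ((conserves_dec h4).seq ((conserves_inc hc).seq (conserves_inc h6))).loop.seq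
      ((conserves_inc hc).seq (((conserves_dec h6).seq (conserves_incr (i + 1))).loop.seq
        ((conserves_dec hc).seq (hstep.seq hbody)).loop))

/-- The counters `x`, `y` have ratio `4 ^ E - 1`, and the exponent is `v`. -/
structure Ratio (E v : ℕ) (α : Config) : Prop where
  pos : 1 ≤ α 0
  sum : α 0 + α 1 = 4 ^ E * α 0
  two : α 2 = 0
  three : α 3 = 0
  exponent : α 4 = v

/-- Provided that all budgets up to level `i` are used up, the ratio corresponds to the exponent `v`
and all controls up to level `i` are zero. -/
def Clean (i v : ℕ) (α : Config) : Prop :=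
  (∀ k ≤ i, α (budget k) = 0) → Ratio v v α ∧ ∀ k ≤ i, α (control k) = 0

/-- The configurations in which `ampBody i` starts if the preceding step was a pass and the exponent
is `V`. -/
structure BodyStart (i V : ℕ) (α : Config) : Prop where
  pos : 1 ≤ α 0
  eq_zero : ∀ z ∈ pool i, z ≠ 0 → α z = 0
  exponent : α 4 = V
  control_eq_zero : ∀ k ≤ i, α (control k) = 0
  sum : α 0 + α (budget i) = 2 ^ (2 * V + 1) * α 0

/-- Correctness of `ampBody i`. -/
def BodySpec (i : ℕ) : Prop :=
  ∀ V α β, (ampBody i).Run α β → BodyStart i V α → Clean i (fastF (i + 1) V) β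

theorem Ratio.congr {E v : ℕ} {α β : Config} (h : Ratio E v α) (h' : ∀ z ≤ 4, β z = α z) :
    Ratio E v β := by
  obtain ⟨pos, sum, two, three, exponent⟩ := h
  constructor <;> simpa only [h' 0 (by norm_num), h' 1 (by norm_num), h' 2 (by norm_num),
    h' 3 (by norm_num), h' 4 le_rfl]

theorem Ratio.inc_four {E v : ℕ} {α β : Config} (h : Ratio E v α) (hr : (inc 4).Run α β) :
    Ratio E (v + 1) β := by
  obtain ⟨pos, sum, two, three, exponent⟩ := h
  have hα : ∀ z < 4, β z = α z := fun z hz => (hr.1 z hz.ne).symm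
  constructor <;> simpa only [hα 0 (by norm_num), hα 1 (by norm_num), hα 2 (by norm_num),
    hα 3 (by norm_num), hr.2, Nat.add_right_cancel_iff]

theorem Clean.congr {i v : ℕ} {α β : Config} (h : Clean i v α) (h' : ∀ z ≤ control i, β z = α z) :
    Clean i v β := by
  intro hb
  obtain ⟨hratio, hcontrol⟩ := h fun k hk => by rw [← hb k hk, h' _ (by grind)]
  exact ⟨hratio.congr fun z hz => h' z (by grind), fun k hk => by
    rw [h' _ (by grind), hcontrol k hk]⟩

/-! ### Soundness of the amplifiers -/

theorem incr_step_ratio {i E v : ℕ} {α β : Config}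
    (h : IsPass (pool i) 4 2 0 1 2 3 (budget i) 1 α β) (hα : Ratio E v α) :
    Ratio (E + 1) v β := by
  obtain ⟨j, hα0, hβ0, hβ1⟩ := h.divided hα.two hα.three
  have hpos := hα.pos
  have hsum := hα.sum
  refine ⟨by omega, ?_, h.eq_zero 2 (by grind) (by norm_num) (by norm_num),
    h.eq_zero 3 (by grind) (by norm_num) (by norm_num), ?_⟩
  · rw [hβ0, hβ1, pow_succ]
    rw [hα0] at hsum
    linarith
  · rw [h.frame 4 (by grind), hα.exponent]

theorem incr_pays (i E v : ℕ) : Pays (balance 2 (pool i) (budget i)) 1 (incr (budget i))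
    (Ratio E v) (Ratio (E + 1) (v + 1)) := by
  have hstep := (stepCounters_incr i).pays (a := 4) (P := Ratio E v) (by norm_num) one_le_two
    fun _ _ => incr_step_ratio
  have hinc : Pays (balance 2 (pool i) (budget i)) 0 (inc 4)
      (Ratio (E + 1) v) (Ratio (E + 1) (v + 1)) := fun α β h =>
    .of_eq (balance_congr (h.1 _ (by grind)).symm (conserves_inc (by grind) _ _ h))
      fun hα => hα.inc_four h
  exact hstep.seq hinc

theorem amp_step_bodyStart {i μ V : ℕ} (hμ : 1 ≤ μ) {α β : Config}
    (h : IsPass (pool (i + 1)) 2 μ 0 1 2 3 (budget (i + 1)) (budget i) α β) (hα : Clean i V α) :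
    BodyStart i V β := by
  obtain ⟨hratio, hcontrol⟩ := hα fun k hk => h.eq_zero_of_ne _ (by grind) (by grind)
  obtain ⟨j, hα0, hβ0, hβb⟩ := h.divided hratio.two hratio.three
  have hpos := hratio.pos
  have hj : 1 ≤ μ * j := Nat.mul_pos hμ (by omega)
  refine ⟨by omega, fun z hz h0 =>
    h.eq_zero z (pool_succ i ▸ Finset.mem_insert_of_mem hz) h0 (by grind), ?_, fun k hk => ?_, ?_⟩
  · rw [h.frame 4 (by grind), hratio.exponent]
  · rw [h.frame _ (by grind), hcontrol k hk]
  · have hsum := hratio.sum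
    calc β 0 + β (budget i) = μ * (α 0 + α 1) := by rw [hβ0, hβb, hα0]; ring
      _ = 2 ^ (2 * V + 1) * β 0 := by
        rw [hsum, hβ0, hα0, pow_succ, pow_mul]
        norm_num
        ring

theorem amp_pays {i μ : ℕ} (hi : BodySpec i) (hμ : 1 ≤ μ) (V : ℕ) :
    Pays (balance μ (pool (i + 1)) (budget (i + 1))) 1 (amp i μ) (Clean i V)
      (Clean i (fastF (i + 1) V)) := by
  have hstep := (stepCounters_amp i).pays (a := 2) (P := Clean i V) one_le_two hμ
    fun _ _ => amp_step_bodyStart hμ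
  have hbody : Pays (balance μ (pool (i + 1)) (budget (i + 1))) 0 (ampBody i) (BodyStart i V)
      (Clean i (fastF (i + 1) V)) := fun α β h =>
    .of_eq (balance_congr (h.frame (budget_succ_notMem_ampBody i)) (conserves_ampBody i _ _ h))
      (hi V α β h)
  exact hstep.seq hbody

theorem balance_congr_of_notMem {μ : ℕ} {Z : Finset ℕ} {o c : ℕ} (hc : c ∉ Z) (ho : o ≠ c)
    {α β : Config} (h : ∀ z, z ≠ c → β z = α z) (R : ℕ) :
    balance μ Z o R β = balance μ Z o R α :=
  balance_congr (h o ho) (total_congr fun z hz => h z fun h => hc (h ▸ hz)) R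

theorem BodyStart.total_eq {i V : ℕ} {α : Config} (h : BodyStart i V α) : total (pool i) α = α 0 :=
  Finset.sum_eq_single 0 h.eq_zero fun h0 => (h0 (by grind)).elim

theorem BodyStart.balance_eq_zero {i V : ℕ} {α : Config} (h : BodyStart i V α) :
    balance 2 (pool i) (budget i) (2 * V + 1) α = 0 := by
  have geom := geom_sum_mul (2 : ℤ) (2 * V + 1)
  have hsum := h.sum
  zify at hsum
  norm_num at geom
  rw [balance, h.total_eq]
  push_cast
  rw [geom]
  linarith

theorem BodyStart.congr {i V : ℕ} {α ρ : Config} (h : BodyStart i V α)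
    (hρ : ∀ z, z < 4 ∨ z % 2 = 1 → ρ z = α z) :
    balance 2 (pool i) (budget i) (2 * V + 1) ρ = 0 ∧ Ratio 0 (ρ 4) ρ := by
  refine ⟨?_, ?_, ?_, ?_, ?_, rfl⟩
  · rw [← h.balance_eq_zero]
    exact balance_congr (hρ _ (by grind)) (total_congr fun z hz => hρ z (by grind)) _
  · simpa [hρ] using h.pos
  · simp [hρ, h.eq_zero 1 (by grind)]
  · simp [hρ, h.eq_zero 2 (by grind)]
  · simp [hρ, h.eq_zero 3 (by grind)]

theorem BodyStart.total_pos {i V : ℕ} {α β : Config} (h : BodyStart i V α)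
    (hr : (ampBody i).Run α β) (hβ : β (budget i) = 0) : 1 ≤ total (pool i) β := by
  have hconserves := conserves_ampBody i _ _ hr
  rw [pool_succ, total_insert (by grind), total_insert (by grind), hβ] at hconserves
  have := h.total_eq
  have := h.pos
  omega

theorem bodySpec_zero : BodySpec 0 := by
  intro V α β h hα hβ
  obtain ⟨ρ, hmove, τ, hloop, hlast⟩ := id h
  have hρ4 : ρ 4 + ρ 6 = V := by
    have hα6 : α 6 = 0 := hα.control_eq_zero 0 le_rfl
    obtain ⟨m, e⟩ := run_move hmove
    have e4 := DFunLike.congr_fun e 4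
    have e6 := DFunLike.congr_fun e 6
    simp only [Finsupp.add_apply, single_apply, control] at e4 e6
    grind [hα.exponent]
  obtain ⟨hbalance, hratio⟩ := hα.congr fun z hz =>
    hmove.frame (by simp only [move, counters, Finset.mem_union, Finset.mem_singleton]; grind)
  obtain ⟨q, hq, hpaid⟩ := Pays.loop_dec (Φ := balance 2 (pool 0) (budget 0)) (k := 2)
    (P := fun j => Ratio (2 * j) (ρ 4 + 2 * j))
    (fun j => (incr_pays 0 (2 * j) (ρ 4 + 2 * j)).seq (incr_pays 0 (2 * j + 1) (ρ 4 + 2 * j + 1)))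
    (by simp [counters, counters_incr, control])
    (fun α β h => balance_congr_of_notMem (by grind) (by norm_num) h)
    (fun i α β h hα => hα.congr fun z hz => h z (by grind)) hloop
  obtain ⟨hqV, hβratio⟩ := (hpaid.trans (incr_pays 0 _ _ _ _ hlast)).exact (by grind)
    hbalance (hβ 0 le_rfl) (hα.total_pos h (hβ 0 le_rfl))
  obtain rfl : q = V := by omega
  have hβ6 : β 6 = τ 6 := hlast.frame (by simp [counters_incr])
  rw [show ρ 4 = 0 by grind] at hβratio hratio
  refine ⟨by simpa [fastF_one] using hβratio hratio, fun k hk => ?_⟩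
  obtain rfl : k = 0 := by omega
  grind

theorem BodyStart.copyExponent {i V : ℕ} {α ρ : Config} (hα : BodyStart (i + 1) V α)
    (h : (seq (loop (seq (dec 4) (seq (inc (control (i + 1))) (inc (control 0)))))
      (inc (control (i + 1)))).Run α ρ) :
    ∃ m, ρ 4 + m = V ∧ ρ (control 0) = m ∧ ρ (control (i + 1)) = m + 1 ∧
      ∀ z, z ≠ 4 → z ≠ control 0 → z ≠ control (i + 1) → ρ z = α z := by
  obtain ⟨σ, hcopy, hinc⟩ := id h
  obtain ⟨m, e⟩ := (((replaces_inc (control 0)).incs (control (i + 1)) 1).dec_seq 4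
    ).exists_nsmul_of_loop hcopy
  have e_apply (z : ℕ) := DFunLike.congr_fun e z
  simp only [smul_add, smul_single, smul_eq_mul, mul_one, zero_add, Finsupp.add_apply,
    single_apply] at e_apply
  have hσ : ∀ z, z ≠ control (i + 1) → ρ z = σ z := fun z hz => (hinc.1 z hz).symm
  refine ⟨m, ?_, ?_, ?_, fun z h4 h6 hc => h.frame (by simp [counters, h4, h6, hc])⟩
  · grind [e_apply 4, hα.exponent]
  · grind [e_apply (control 0), hα.control_eq_zero 0 (by omega)]
  · grind [e_apply (control (i + 1)), hα.control_eq_zero (i + 1) le_rfl, hinc.2]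

theorem bodySpec_succ {i : ℕ} (hi : BodySpec i) : BodySpec (i + 1) := by
  intro V α β h hα hβ
  obtain ⟨ρ₀, hcopy, ρ, hinc, τ, hincr, hamp⟩ := id (ampBody_succ i ▸ h)
  have hc : control (i + 1) ∉ pool (i + 1) := by grind
  obtain ⟨m, hρ4, hρ6, hρc, hρ⟩ := hα.copyExponent ⟨ρ₀, hcopy, hinc⟩
  have hτ : ∀ z, 6 < z → z ≠ budget (i + 1) → τ z = ρ z := fun z h6 ho => by
    refine hincr.frame ?_
    simp only [counters, counters_incr, Finset.mem_union, Finset.mem_insert, Finset.mem_singleton]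
    grind
  have hτc := hτ (control (i + 1)) (by grind) (by grind)
  obtain ⟨hbalance, hratio⟩ := hα.congr fun z hz => hρ z (by grind) (by grind) (by grind)
  obtain ⟨q, hq, hpaid⟩ := Pays.loop_dec (Φ := balance 2 (pool (i + 1)) (budget (i + 1)))
    (P := fun j => Ratio j (ρ 4 + j)) (fun j => incr_pays (i + 1) j (ρ 4 + j))
    (by rw [counters_incr]; grind)
    (fun α β h => balance_congr_of_notMem (by grind) (by grind) h)
    (fun i α β h hα => hα.congr fun z hz => h z (by grind)) hincr
  obtain ⟨q', hq', hpaid'⟩ := Pays.loop_dec (Φ := balance 2 (pool (i + 1)) (budget (i + 1)))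
    (P := fun j => Clean i ((fastF (i + 1))^[j] V))
    (fun j => by
      rw [Function.iterate_succ_apply']
      exact amp_pays hi one_le_two _)
    (by rw [counters_amp]; grind)
    (fun α β h => balance_congr_of_notMem hc (by grind) h)
    (fun j α β h hα => hα.congr fun z hz => h z (by grind)) hamp
  have hclean : Ratio q (ρ 4 + q) τ → q = V → Clean i V τ := fun hτratio hqV _ =>
    ⟨by rwa [show ρ 4 + q = V by grind, hqV] at hτratio, fun k hk => by
      obtain rfl | hk0 := k.eq_zero_or_pos
      · grind
      · rw [hτ _ (by grind) (by grind), hρ _ (by grind) (by grind) (by grind),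
          hα.control_eq_zero k (by omega)]⟩
  obtain ⟨hN, hβclean⟩ := (hpaid.trans ((Paid.of_eq (fun _ => rfl) hclean).trans
      (hpaid'.imp (q = V)))).exact (by grind) hbalance (hβ _ le_rfl) (hα.total_pos h (hβ _ le_rfl))
  have hqV : q = V := by grind
  obtain rfl : q' = V + 1 := by omega
  obtain ⟨hβratio, hβcontrol⟩ := hβclean hratio hqV fun k hk => hβ k (by omega)
  refine ⟨hβratio, fun k hk => ?_⟩
  obtain hk | rfl := Nat.le_succ_iff.1 hk
  · exact hβcontrol k hk
  · grind

theorem bodySpec (i : ℕ) : BodySpec i := by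
  induction i with
  | zero => exact bodySpec_zero
  | succ i ih => exact bodySpec_succ ih

/-! ### Complete runs of the amplifiers -/

@[simp]
theorem testFree_incr (o : ℕ) : (incr o).TestFree := ⟨testFree_step .., trivial⟩

theorem testFree_ampBody (i : ℕ) : (ampBody i).TestFree := by
  induction i with
  | zero => simp [ampBody, move, TestFree]
  | succ i ih => simp [ampBody, TestFree, ih]

theorem testFree_amp (i μ : ℕ) : (amp i μ).TestFree := ⟨testFree_step .., testFree_ampBody i⟩

/-- The configuration with exponent `v` where `x` is `X` and the ratio corresponds to `v`. -/
noncomputable def scaled (v X : ℕ) : Config := single 0 X + single 1 ((4 ^ v - 1) * X) + single 4 v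

/-- `scaled v X`, where `o` can exactly pay for `R` passes that multiply by `μ`. -/
noncomputable def funded (μ o R v X : ℕ) : Config :=
  scaled v X + single o ((∑ i ∈ Finset.range R, μ ^ i) * (4 ^ v * X))

theorem funded_zero (μ o v X : ℕ) : funded μ o 0 v X = scaled v X := by
  simp [funded]

theorem scaled_zero (X : ℕ) : scaled 0 X = single 0 X := by
  simp [scaled]

/-- The hypothesis says that a pass multiplies the total content by `μ`. -/
theorem funded_succ {μ v w X z : ℕ} (h : μ * (4 ^ v * X) = 4 ^ w * z) (o R : ℕ) :
    funded μ o (R + 1) v X = scaled v X + single o (4 ^ v * X) +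
      single o ((∑ i ∈ Finset.range R, μ ^ i) * (4 ^ w * z)) := by
  rw [funded, geom_sum_succ, add_assoc (scaled v X), ← single_add, ← h]
  congr 2
  ring

theorem exists_four_pow_eq_succ (v : ℕ) : ∃ k, 4 ^ v = k + 1 :=
  Nat.exists_eq_add_one.2 (by positivity)

theorem incr_run (o R v : ℕ) {X : ℕ} (hX : 2 ∣ X) :
    (incr o).Run (funded 2 o (R + 1) v (2 * X)) (funded 2 o R (v + 1) X) := by
  obtain ⟨h, rfl⟩ := hX
  obtain ⟨k, hk⟩ := exists_four_pow_eq_succ v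
  have hcost : 4 ^ v * (2 * (2 * h)) = h + (k * (4 * h) + (4 - 1) * h) := by rw [hk]; ring
  have hy : (4 ^ (v + 1) - 1) * (2 * h) = 2 * (k * (4 * h) + (4 - 1) * h) := by
    rw [pow_succ, hk, show (k + 1) * 4 - 1 = 4 * k + 3 by omega]
    ring
  have hstep := step_run one_le_two 4 0 1 2 3 o 1 h (k * (4 * h)) (single 4 v)
  rw [funded_succ (w := v + 1) (z := 2 * h) (by ring), funded]
  refine Run.add_right (testFree_incr o) ⟨_, hstep.of_eq_add (testFree_step ..) 0 ?_ rfl, ?_⟩ _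
  · rw [scaled, hcost, hk, Nat.add_sub_cancel, show 2 * (2 * h) = 4 * h by ring]
    abel
  · rw [run_inc, scaled, hy, single_add 4]
    abel

theorem loop_incr_run (o c R q v : ℕ) {X : ℕ} (hX : 2 ∣ X) :
    (loop (seq (dec c) (incr o))).Run (funded 2 o (R + q) v (2 ^ q * X) + single c q)
      (funded 2 o R (v + q) X) := by
  have hrun := loop_dec_run (testFree_incr o) c (q := q)
    (s := fun j => funded 2 o (R + (q - j)) (v + j) (2 ^ (q - j) * X)) fun j hj => by
      obtain ⟨l, rfl⟩ := Nat.exists_eq_add_of_lt hj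
      have hrun := incr_run o (R + l) (v + j) (hX.mul_left (2 ^ l))
      rw [show j + l + 1 - j = l + 1 by omega, show j + l + 1 - (j + 1) = l by omega, pow_succ',
        mul_assoc]
      exact hrun
  simpa using hrun

theorem loop_double_incr_run (o c R q v : ℕ) {X : ℕ} (hX : 2 ∣ X) :
    (loop (seq (dec c) (seq (incr o) (incr o)))).Run
      (funded 2 o (R + 2 * q) v (2 ^ (2 * q) * X) + single c q) (funded 2 o R (v + 2 * q) X) := by
  have hrun := loop_dec_run (M := seq (incr o) (incr o)) (by simp [TestFree]) c (q := q)
    (s := fun j => funded 2 o (R + 2 * (q - j)) (v + 2 * j) (2 ^ (2 * (q - j)) * X)) fun j hj => by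
      obtain ⟨l, rfl⟩ := Nat.exists_eq_add_of_lt hj
      have hfst := incr_run o (R + 2 * l + 1) (v + 2 * j) (hX.mul_left (2 ^ (2 * l + 1)))
      have hsnd := incr_run o (R + 2 * l) (v + 2 * j + 1) (hX.mul_left (2 ^ (2 * l)))
      rw [pow_succ', mul_assoc] at hfst
      rw [show j + l + 1 - j = l + 1 by omega, show j + l + 1 - (j + 1) = l by omega,
        mul_add_one 2 l, pow_succ', pow_succ', mul_assoc, mul_assoc]
      exact ⟨_, hfst, hsnd⟩
  simpa using hrun

/-- Complete runs of `ampBody i`, with prescribed final value `z` of `x`. -/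
def BodyRun (i : ℕ) : Prop :=
  ∀ V z, 2 ∣ z → ∃ X, 2 ∣ X ∧ 2 ^ (2 * V + 1) * X = 4 ^ fastF (i + 1) V * z ∧
    (ampBody i).Run (funded 2 (budget i) (2 * V + 1) 0 X + single 4 V)
      (scaled (fastF (i + 1) V) z)

theorem amp_run {i μ : ℕ} (hi : BodyRun i) (hμ : μ ∣ 2) (R V z : ℕ) (hz : 2 ∣ z) :
    ∃ X, 2 ∣ X ∧ μ * (4 ^ V * X) = 4 ^ fastF (i + 1) V * z ∧
      (amp i μ).Run (funded μ (budget (i + 1)) (R + 1) V X)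
        (funded μ (budget (i + 1)) R (fastF (i + 1) V) z) := by
  obtain ⟨X, hX, hXz, hrun⟩ := hi V z hz
  obtain ⟨h, rfl⟩ := hμ.trans hX
  obtain ⟨k, hk⟩ := exists_four_pow_eq_succ V
  have hpow : 2 ^ (2 * V + 1) = 2 * 4 ^ V := by rw [pow_succ', pow_mul]; norm_num
  have hz : μ * (4 ^ V * (2 * h)) = 4 ^ fastF (i + 1) V * z := by
    rw [← hXz, hpow]
    ring
  have hgeom : ∑ i ∈ Finset.range (2 * V + 1), 2 ^ i = 2 * k + 1 := by
    rw [Nat.geomSum_eq le_rfl, hpow, hk]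
    omega
  have hstep := step_run (Nat.pos_of_dvd_of_pos hμ two_pos) 2 0 1 2 3 (budget (i + 1)) (budget i) h
    (k * (2 * h)) (single 4 V)
  refine ⟨2 * h, dvd_mul_right 2 h, hz, ?_⟩
  rw [funded_succ hz, funded]
  refine Run.add_right (testFree_amp i μ)
    ⟨_, hstep.of_eq_add (testFree_step ..) 0 ?_ rfl, hrun.of_eq_add (testFree_ampBody i) 0 ?_ ?_⟩ _
  · rw [scaled, hk, Nat.add_sub_cancel,
      show (k + 1) * (2 * h) = h + (k * (2 * h) + (2 - 1) * h) by ring]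
    abel
  · rw [funded, scaled_zero, hgeom, show (2 * k + 1) * (4 ^ 0 * (μ * h)) =
      μ * (k * (2 * h) + (2 - 1) * h) by ring]
    abel
  · rw [add_zero]

theorem loop_amp_run {i : ℕ} (hi : BodyRun i) (c R q V z : ℕ) (hz : 2 ∣ z) :
    ∃ X, 2 ∣ X ∧ 2 ^ q * (4 ^ V * X) = 4 ^ (fastF (i + 1))^[q] V * z ∧
      (loop (seq (dec c) (amp i 2))).Run (funded 2 (budget (i + 1)) (R + q) V X + single c q)
        (funded 2 (budget (i + 1)) R ((fastF (i + 1))^[q] V) z) := by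
  induction q generalizing V with
  | zero => exact ⟨z, hz, by simp, by simpa using loop_run_self _ _⟩
  | succ q ih =>
    obtain ⟨X', hX', hX'z, hrun'⟩ := ih (fastF (i + 1) V)
    obtain ⟨X, hX, hXX', hrun⟩ := amp_run hi dvd_rfl (R + q) V X' hX'
    refine ⟨X, hX, ?_, .head ⟨_, run_dec.2 ?_, hrun.add_right (testFree_amp i 2) (single c q)⟩
      hrun'⟩
    · rw [Function.iterate_succ_apply, ← hX'z, ← hXX']
      ring
    · rw [single_add, ← add_assoc, ← add_assoc]

theorem bodyRun_zero : BodyRun 0 := by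
  intro V z hz
  refine ⟨2 ^ (2 * V) * (2 * z), (dvd_mul_right 2 z).mul_left _, ?_, ?_⟩
  · rw [fastF_one, show (4 : ℕ) = 2 * 2 by norm_num, mul_pow]
    ring
  · have hloop := loop_double_incr_run (budget 0) (control 0) 1 V 0 (dvd_mul_right 2 z)
    have hlast := incr_run (budget 0) 0 (2 * V) hz
    rw [funded_zero] at hlast
    rw [zero_add, add_comm 1] at hloop
    rw [fastF_one]
    exact ⟨_, move_run .., _, hloop, hlast⟩

theorem copyExponent_run (c c' V : ℕ) (γ : Config) :
    (seq (loop (seq (dec 4) (seq (inc c) (inc c')))) (inc c)).Run (γ + single 4 V)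
      (γ + single c (V + 1) + single c' V) := by
  have hcopy := (((replaces_inc c').incs c 1).dec_seq 4).loop_run V γ
  refine ⟨_, by simpa [incs] using hcopy, ?_⟩
  rw [run_inc, single_add]
  abel

theorem bodyRun_succ {i : ℕ} (hi : BodyRun i) : BodyRun (i + 1) := by
  intro V z hz
  obtain ⟨X, hX, hXz, hamp⟩ := loop_amp_run hi (control (i + 1)) 0 (V + 1) V z hz
  refine ⟨2 ^ V * X, hX.mul_left _, ?_, ?_⟩
  · rw [fastF, ← hXz, show (4 : ℕ) = 2 * 2 by norm_num, mul_pow]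
    ring
  · obtain ⟨ρ, hcopy, hinc⟩ := copyExponent_run (control (i + 1)) (control 0) V
      (funded 2 (budget (i + 1)) (2 * V + 1) 0 (2 ^ V * X))
    have hincr := (loop_incr_run (budget (i + 1)) (control 0) (V + 1) V 0 hX).add_right
      (M := loop (seq (dec _) (incr _))) ⟨trivial, testFree_incr _⟩
      (single (control (i + 1)) (V + 1))
    rw [funded_zero, zero_add] at hamp
    rw [zero_add, show V + 1 + V = 2 * V + 1 by ring, add_right_comm] at hincr
    exact ⟨ρ, hcopy, _, hinc, _, hincr, hamp⟩

theorem bodyRun (i : ℕ) : BodyRun i := by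
  induction i with
  | zero => exact bodyRun_zero
  | succ i ih => exact bodyRun_succ ih

/-! ### The final part -/

/-- Double the counter `6` by way of `7`. -/
def double : Program := seq (loop (seq (dec 6) (seq (inc 7) (inc 7)))) (move 7 6)

/-- Double the power of two in `6` and the corresponding ratio, in two passes. In the final part
the counters `x`, `y`, `x'`, `y'` of the basic step are `0`, `3`, `2`, `5`, and the budget is
`1`. -/
def expoStep (μ : ℕ) : Program :=
  seq (step 2 μ 0 3 2 5 1 3) (seq double (step 1 μ 0 3 2 5 1 3))

/-- Compute in `6` the power of two with exponent `4`. -/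
def expo (μ : ℕ) : Program := seq (inc 6) (loop (seq (dec 4) (expoStep μ)))

/-- Transfer from `0` to `2` one unit, and from `3` to `5` the units that belong to it, as many as
`6` contains. The unit in `0` itself is also counted in `5`. -/
def keepUnit : Program :=
  seq (dec 0) (seq (inc 2) (seq (inc 5)
    (seq (loop (seq (dec 6) (seq (dec 3) (seq (inc 7) (inc 5))))) (move 7 6))))

/-- Remove from `0` one unit, and from `3` what belongs to it. -/
def dropUnit : Program :=
  seq (dec 0) (seq (loop (seq (dec 6) (seq (dec 3) (inc 7)))) (move 7 6))

/-- Compare the ratio of `0` and `3` with the power in `6`, leaving multiples in `2` and `5`. -/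
def settle : Program := seq (dec 6) (seq (loop keepUnit) (seq (loop dropUnit) (inc 6)))

theorem counters_expoStep (μ : ℕ) : (expoStep μ).counters = {0, 1, 2, 3, 5, 6, 7} := by
  simp only [expoStep, counters, counters_step one_le_two, counters_step le_rfl]
  decide

theorem counters_expo (μ : ℕ) : (expo μ).counters = Finset.range 8 := by
  simp only [expo, counters, counters_expoStep]
  decide

theorem counters_settle : settle.counters = {0, 2, 3, 5, 6, 7} := by decide

/-- The configuration has ratio `D` between `0` and the sum of `0` and `3`, and a power of at most
`P`, divided between `6` and `7`. -/
structure PowRatio (D P : ℕ) (α : Config) : Prop where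
  pos : 1 ≤ α 0
  sum : α 0 + α 3 = D * α 0
  two : α 2 = 0
  five : α 5 = 0
  pow : α 6 + α 7 ≤ P

/-- The counters whose content the budget of the final part pays for. -/
def expoPool : Finset ℕ := {0, 2, 3, 5}

theorem stepCounters_expoPool : StepCounters expoPool 0 3 2 5 1 3 :=
  ⟨by decide, by decide, by decide, by decide⟩

theorem run_double {α β : Config} (h : double.Run α β) : β 6 + β 7 ≤ 2 * (α 6 + α 7) := by
  obtain ⟨ρ, hdouble, hmove⟩ := h
  obtain ⟨i, hi⟩ := (((replaces_inc 7).incs 7 1).dec_seq 6).exists_nsmul_of_loop hdouble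
  obtain ⟨j, hj⟩ := run_move hmove
  simp only [Finsupp.ext_iff, Finsupp.add_apply, Finsupp.smul_apply, single_apply,
    Finsupp.zero_apply, smul_eq_mul] at hi hj
  have hi6 := hi 6
  have hi7 := hi 7
  have hj6 := hj 6
  have hj7 := hj 7
  simp only [Nat.reduceEqDiff, reduceIte] at hi6 hi7 hj6 hj7
  omega

theorem double_frame {α β : Config} (h : double.Run α β) {z : ℕ} (hz : z ∉ ({6, 7} : Finset ℕ)) :
    β z = α z := h.frame (by rwa [show double.counters = {6, 7} by decide])

theorem PowRatio.congr {D P Q : ℕ} {α β : Config} (hα : PowRatio D P α)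
    (h : ∀ z ∈ ({0, 2, 3, 5} : Finset ℕ), β z = α z) (hpow : β 6 + β 7 ≤ Q) : PowRatio D Q β where
  pos := by grind [hα.pos]
  sum := by grind [hα.sum]
  two := by grind [hα.two]
  five := by grind [hα.five]
  pow := hpow

theorem pays_ratio_step {a μ : ℕ} (ha : 1 ≤ a) (hμ : 1 ≤ μ) (D P : ℕ) :
    Pays (balance μ expoPool 1) 1 (step a μ 0 3 2 5 1 3) (PowRatio D P) (PowRatio (a * D) P) := by
  refine stepCounters_expoPool.pays ha hμ fun α β hpass hα => ?_
  obtain ⟨i, hα0, hβ0, hβ3⟩ := hpass.divided hα.two hα.five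
  have hpos := hα.pos
  have hsum := hα.sum
  refine ⟨?_, ?_, hpass.eq_zero 2 (by decide) (by decide) (by decide),
    hpass.eq_zero 5 (by decide) (by decide) (by decide), ?_⟩
  · rw [hβ0]
    exact Nat.mul_pos hμ (Nat.pos_of_mul_pos_left (hα0 ▸ hpos))
  · obtain ⟨b, rfl⟩ := Nat.exists_eq_add_of_le' ha
    rw [hβ0, hβ3, Nat.add_sub_cancel]
    rw [hα0] at hsum
    linear_combination μ * hsum
  · rw [hpass.frame 6 (by decide), hpass.frame 7 (by decide)]
    exact hα.pow

theorem expoStep_pays {μ : ℕ} (hμ : 1 ≤ μ) (i : ℕ) :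
    Pays (balance μ expoPool 1) 2 (expoStep μ) (PowRatio (2 ^ i) (2 ^ i))
      (PowRatio (2 ^ (i + 1)) (2 ^ (i + 1))) := by
  have hdouble : Pays (balance μ expoPool 1) 0 double (PowRatio (2 ^ (i + 1)) (2 ^ i))
      (PowRatio (2 ^ (i + 1)) (2 ^ (i + 1))) := fun α β h => by
    have hframe : ∀ z ∈ expoPool, β z = α z := fun z hz => double_frame h (by grind [expoPool])
    refine .of_eq (balance_congr (double_frame h (by decide)) (total_congr hframe)) fun hα => ?_
    refine hα.congr hframe ((run_double h).trans ?_)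
    rw [pow_succ']
    exact Nat.mul_le_mul_left 2 hα.pow
  have hfst := pays_ratio_step one_le_two hμ (2 ^ i) (2 ^ i)
  have hlast := pays_ratio_step le_rfl hμ (2 ^ (i + 1)) (2 ^ (i + 1))
  rw [← pow_succ'] at hfst
  rw [one_mul] at hlast
  exact hfst.seq (hdouble.seq hlast)

theorem StepCounters.total_le {Z : Finset ℕ} {a μ x y x' y' o t : ℕ}
    (hZ : StepCounters Z x y x' y' o t) (ha : 1 ≤ a) (hμ : 1 ≤ μ) {α β : Config}
    (h : (step a μ x y x' y' o t).Run α β) : total Z α ≤ total Z β := by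
  obtain ⟨e, -, htotal, -⟩ := hZ.step_sound ha hμ h
  have := Nat.le_mul_of_pos_left e hμ
  omega

theorem expo_total_le {μ : ℕ} (hμ : 1 ≤ μ) {α β : Config} (h : (expo μ).Run α β) :
    total expoPool α ≤ total expoPool β := by
  obtain ⟨ρ, hinc, hloop⟩ := h
  refine (conserves_inc (by decide) _ _ hinc).ge.trans
    (hloop.loop_induction (I := fun σ => total expoPool ρ ≤ total expoPool σ) le_rfl ?_)
  rintro σ τ ⟨σ₀, hdec, σ₁, hfst, σ₂, hdouble, hlast⟩ hσ
  calc total expoPool ρ ≤ total expoPool σ := hσ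
    _ = total expoPool σ₀ := (conserves_dec (by decide) _ _ hdec).symm
    _ ≤ total expoPool σ₁ := stepCounters_expoPool.total_le one_le_two hμ hfst
    _ = total expoPool σ₂ := (conserves_of_disjoint (by decide) _ _ hdouble).symm
    _ ≤ total expoPool τ := stepCounters_expoPool.total_le le_rfl hμ hlast

/-- Entry condition of `expo`: the budget in `1` exactly pays for `2 * V` passes. -/
structure ExpoStart (μ V : ℕ) (α : Config) : Prop where
  pos : 1 ≤ α 0
  budget : α 1 = (∑ i ∈ Finset.range (2 * V), μ ^ i) * α 0
  exponent : α 4 = V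
  eq_zero : ∀ z ∈ ({2, 3, 5, 6, 7} : Finset ℕ), α z = 0

theorem expo_sound {μ V : ℕ} (hμ : 1 ≤ μ) {α β : Config} (hα : ExpoStart μ V α)
    (h : (expo μ).Run α β) (hβ : β 1 = 0) : β 4 = 0 ∧ PowRatio (2 ^ V) (2 ^ V) β := by
  have htotal : 1 ≤ total expoPool β :=
    hα.pos.trans ((le_total (Z := expoPool) (by decide) α).trans (expo_total_le hμ h))
  have hzero := hα.eq_zero
  simp only [Finset.mem_insert, Finset.mem_singleton, forall_eq_or_imp, forall_eq] at hzero
  obtain ⟨_, hinc, hloop⟩ := h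
  obtain rfl := run_inc.1 hinc
  obtain ⟨q, hq, hpaid⟩ := Pays.loop_dec (P := fun i => PowRatio (2 ^ i) (2 ^ i))
    (expoStep_pays hμ) (by rw [counters_expoStep]; decide)
    (fun α β h => balance_congr (h 1 (by decide)) (total_congr fun z hz => h z
      (by grind [expoPool])))
    (fun i α β h hα => hα.congr (fun z hz => h z (by grind))
      (by rw [h 6 (by decide), h 7 (by decide)]; exact hα.pow)) hloop
  have hq4 : β 4 + q = V := by simpa [hα.exponent] using hq
  have hbalance : balance μ expoPool 1 (2 * V) (α + single 6 1) = 0 := by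
    simp [balance, total, expoPool, hα.budget, hzero]
  obtain ⟨hqV, hpow⟩ := hpaid.exact (by omega) hbalance hβ htotal
  obtain rfl : q = V := by omega
  exact ⟨by omega, hpow ⟨by simpa using hα.pos, by simp [hzero], by simp [hzero], by simp [hzero],
    by simp [hzero]⟩⟩

/-- Invariant of the loops of `settle`, where `6` and `7` together contain `B`: each unit in `2` is
matched by at most `B + 1` units in `5`, and `L` units are in excess. -/
structure SettleInv (B L : ℕ) (α : Config) : Prop where
  power : α 6 + α 7 = B
  content : L + B * α 0 + (B + 1) * α 2 ≤ α 3 + α 5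
  output : α 5 ≤ (B + 1) * α 2

theorem SettleInv.keepUnit {B L : ℕ} {α β : Config} (hα : SettleInv B L α)
    (h : keepUnit.Run α β) : SettleInv B L β := by
  obtain ⟨hpower, hcontent, houtput⟩ := hα
  obtain ⟨u, hdec, v, hinc2, w, hinc5, y, hloop, hmove⟩ := h
  obtain ⟨e, he⟩ :=
    ((((replaces_inc 5).incs 7 1).dec_seq 3).dec_seq 6).exists_nsmul_of_loop hloop
  obtain ⟨j, hj⟩ := run_move hmove
  obtain rfl := run_inc.1 hinc5
  obtain rfl := run_inc.1 hinc2
  obtain rfl := run_dec.1 hdec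
  have apply_eq (z : ℕ) := And.intro (DFunLike.congr_fun he z) (DFunLike.congr_fun hj z)
  have h0 := apply_eq 0
  have h2 := apply_eq 2
  have h3 := apply_eq 3
  have h5 := apply_eq 5
  have h6 := apply_eq 6
  have h7 := apply_eq 7
  simp only [Finsupp.add_apply, Finsupp.smul_apply, single_apply, Finsupp.zero_apply, smul_eq_mul,
    Nat.reduceEqDiff, OfNat.ofNat_ne_zero, OfNat.zero_ne_ofNat, reduceIte, add_zero]
    at h0 h2 h3 h5 h6 h7 hpower hcontent houtput
  have hle : e ≤ B := by omega
  have hβ2 : β 2 = u 2 + 1 := by omega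
  rw [mul_add_one] at hcontent
  refine ⟨by omega, ?_, ?_⟩
  · rw [hβ2, mul_add_one (B + 1), show β 0 = u 0 by omega]
    omega
  · rw [hβ2, mul_add_one]
    omega

theorem SettleInv.dropUnit {B L : ℕ} {α β : Config} (hα : SettleInv B L α)
    (h : dropUnit.Run α β) : SettleInv B L β := by
  obtain ⟨hpower, hcontent, houtput⟩ := hα
  obtain ⟨u, hdec, y, hloop, hmove⟩ := h
  obtain ⟨e, he⟩ := (((replaces_inc 7).dec_seq 3).dec_seq 6).exists_nsmul_of_loop hloop
  obtain ⟨j, hj⟩ := run_move hmove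
  obtain rfl := run_dec.1 hdec
  have apply_eq (z : ℕ) := And.intro (DFunLike.congr_fun he z) (DFunLike.congr_fun hj z)
  have h0 := apply_eq 0
  have h2 := apply_eq 2
  have h3 := apply_eq 3
  have h5 := apply_eq 5
  have h6 := apply_eq 6
  have h7 := apply_eq 7
  simp only [Finsupp.add_apply, Finsupp.smul_apply, single_apply, Finsupp.zero_apply, smul_eq_mul,
    Nat.reduceEqDiff, OfNat.ofNat_ne_zero, OfNat.zero_ne_ofNat, reduceIte, add_zero]
    at h0 h2 h3 h5 h6 h7 hpower hcontent houtput
  have hβ2 : β 2 = u 2 := by omega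
  rw [mul_add_one] at hcontent
  refine ⟨by omega, ?_, ?_⟩
  · rw [hβ2, show β 0 = u 0 by omega]
    omega
  · rw [hβ2]
    omega

theorem settle_sound {K : ℕ} {α β : Config} (hα : PowRatio K K α) (h : settle.Run α β)
    (hβ : ∀ z ∈ ({0, 3, 7} : Finset ℕ), β z = 0) : β 6 = K ∧ β 5 = K * β 2 := by
  simp only [Finset.mem_insert, Finset.mem_singleton, forall_eq_or_imp, forall_eq] at hβ
  obtain ⟨hpos, hsum, h2, h5, hpow⟩ := hα
  obtain ⟨ρ, hdec, τ, hkeep, σ, hdrop, hinc⟩ := h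
  obtain rfl := run_dec.1 hdec
  obtain rfl := run_inc.1 hinc
  simp only [Finsupp.add_apply, single_apply, Nat.reduceEqDiff, reduceIte, add_zero]
    at hβ hpos hsum h2 h5 hpow
  obtain ⟨D, rfl⟩ : ∃ D, K = ρ 6 + ρ 7 + 1 + D := ⟨K - (ρ 6 + ρ 7 + 1), by omega⟩
  have hρ : SettleInv (ρ 6 + ρ 7) (D * ρ 0) ρ := ⟨rfl, by rw [h2, h5]; nlinarith, by simp [h5]⟩
  have hτ := hkeep.loop_induction hρ fun _ _ hr hσ => SettleInv.keepUnit hσ hr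
  obtain ⟨hpower, hcontent, houtput⟩ :=
    hdrop.loop_induction hτ fun _ _ hr hσ => SettleInv.dropUnit hσ hr
  rw [hβ.1, hβ.2.1] at hcontent
  obtain rfl : D = 0 := by
    have hD : D * ρ 0 = 0 := by omega
    exact (mul_eq_zero.1 hD).resolve_right (by omega)
  simp
  omega

theorem expo_settle_sound {μ V : ℕ} (hμ : 1 ≤ μ) {α β : Config} (hα : ExpoStart μ V α)
    (h : (seq (expo μ) settle).Run α β) (hβ : ∀ z ∈ ({0, 1, 3, 7} : Finset ℕ), β z = 0) :
    β 4 = 0 ∧ β 6 = 2 ^ V ∧ β 5 = 2 ^ V * β 2 := by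
  obtain ⟨ρ, hexpo, hsettle⟩ := h
  have h1 : β 1 = ρ 1 := hsettle.frame (by rw [counters_settle]; decide)
  have h4 : β 4 = ρ 4 := hsettle.frame (by rw [counters_settle]; decide)
  obtain ⟨hρ4, hρ⟩ := expo_sound hμ hα hexpo (h1.symm.trans (hβ 1 (by decide)))
  exact ⟨h4.trans hρ4, settle_sound hρ hsettle fun z hz => hβ z (by grind)⟩

/-! ### Complete runs of the final part -/

@[simp]
theorem testFree_double : double.TestFree := by simp [double, move, TestFree]

@[simp]
theorem testFree_expoStep (μ : ℕ) : (expoStep μ).TestFree := by simp [expoStep, TestFree]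

@[simp]
theorem testFree_expo (μ : ℕ) : (expo μ).TestFree := by simp [expo, TestFree]

theorem testFree_keepUnit : keepUnit.TestFree := by simp [keepUnit, move, TestFree]

theorem testFree_dropUnit : dropUnit.TestFree := by simp [dropUnit, move, TestFree]

@[simp]
theorem testFree_settle : settle.TestFree :=
  ⟨trivial, testFree_keepUnit, testFree_dropUnit, trivial⟩

theorem double_run (m : ℕ) (γ : Config) : double.Run (γ + single 6 m) (γ + single 6 (2 * m)) := by
  have hdouble := (((replaces_inc 7).incs 7 1).dec_seq 6).loop_run m γ
  rw [zero_add, ← single_add, smul_single, smul_single, smul_eq_mul, smul_eq_mul,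
    mul_one] at hdouble
  exact ⟨_, hdouble, mul_comm m 2 ▸ move_run 7 6 (m * 2) γ⟩

/-- The configuration with power `2 ^ i` where `0` is `X` and the ratio corresponds to `2 ^ i`. -/
noncomputable def powered (i X : ℕ) : Config :=
  single 0 X + single 3 ((2 ^ i - 1) * X) + single 6 (2 ^ i)

theorem expoStep_run {μ : ℕ} (hμ : 1 ≤ μ) (i h : ℕ) (γ : Config) : (expoStep μ).Run
    (γ + powered i (2 * h) + single 1 (2 ^ i * (2 * h) + μ * (2 ^ i * (2 * h))))
    (γ + powered (i + 1) (μ * (μ * h))) := by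
  obtain ⟨k, hk⟩ : ∃ k, 2 ^ i = k + 1 := Nat.exists_eq_add_one.2 (by positivity)
  have hk' : 2 ^ (i + 1) - 1 = 2 * k + 1 := by rw [pow_succ, hk]; omega
  have hfst := step_run hμ 2 0 3 2 5 1 3 h (k * (2 * h))
    (γ + single 6 (2 ^ i) + single 1 (μ * (2 ^ i * (2 * h))))
  have hdouble := double_run (2 ^ i) (γ + single 0 (μ * h) +
      single 3 (μ * (k * (2 * h) + (2 - 1) * h)) + single 1 (μ * (2 ^ i * (2 * h))))
  have hlast := step_run hμ 1 0 3 2 5 1 3 (μ * h) ((2 * k + 1) * (μ * h))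
    (γ + single 6 (2 * 2 ^ i))
  have hy : μ * (k * (2 * h) + (2 - 1) * h) = (2 * k + 1) * (μ * h) := by ring
  have hcost : μ * (2 ^ i * (2 * h)) =
      μ * h + ((2 * k + 1) * (μ * h) + (1 - 1) * (μ * h)) := by
    rw [hk, tsub_self]; ring
  refine ⟨_, hfst.of_eq_add (testFree_step ..) 0 ?_ rfl,
    _, hdouble.of_eq_add testFree_double 0 ?_ rfl, hlast.of_eq_add (testFree_step ..) 0 ?_ ?_⟩
  · rw [powered, show 2 ^ i * (2 * h) = h + (k * (2 * h) + (2 - 1) * h) by rw [hk]; ring,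
      single_add 1, hk, Nat.add_sub_cancel]
    abel
  · abel
  · rw [hy, ← hcost, one_mul]
    abel
  · rw [powered, hk', pow_succ', tsub_self, zero_mul, add_zero, mul_left_comm (2 * k + 1) μ]
    abel_nf

theorem loop_expoStep_run {μ : ℕ} (hμ : 1 ≤ μ) (q l : ℕ) :
    (loop (seq (dec 4) (expoStep μ))).Run (powered 0 (2 ^ q * l) +
      single 1 ((∑ j ∈ Finset.range (2 * q), μ ^ j) * (2 ^ q * l)) + single 4 q)
      (powered q (μ ^ (2 * q) * l)) := by
  have hrun := loop_dec_run (testFree_expoStep μ) 4 (q := q)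
    (s := fun j => powered j (2 ^ (q - j) * (μ ^ (2 * j) * l)) +
      single 1 ((∑ i ∈ Finset.range (2 * (q - j)), μ ^ i) * (2 ^ q * (μ ^ (2 * j) * l)))) ?_
  · simpa using hrun
  intro j hj
  obtain ⟨r, rfl⟩ := Nat.exists_eq_add_of_lt hj
  rw [show j + r + 1 - j = r + 1 by omega, show j + r + 1 - (j + 1) = r by omega]
  have hstep := expoStep_run hμ j (2 ^ r * (μ ^ (2 * j) * l))
    (single 1 ((∑ i ∈ Finset.range (2 * r), μ ^ i) *
      (2 ^ (j + r + 1) * (μ ^ (2 * (j + 1)) * l))))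
  have hbudget : (∑ i ∈ Finset.range (2 * (r + 1)), μ ^ i) *
        (2 ^ (j + r + 1) * (μ ^ (2 * j) * l)) =
      2 ^ j * (2 * (2 ^ r * (μ ^ (2 * j) * l))) +
          μ * (2 ^ j * (2 * (2 ^ r * (μ ^ (2 * j) * l)))) +
        (∑ i ∈ Finset.range (2 * r), μ ^ i) * (2 ^ (j + r + 1) * (μ ^ (2 * (j + 1)) * l)) := by
    rw [mul_add_one 2 r, geom_sum_succ, geom_sum_succ]
    ring
  refine hstep.of_eq_add (testFree_expoStep μ) 0 ?_ ?_
  · rw [hbudget, single_add 1, pow_succ' 2 r, mul_assoc 2]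
    abel
  · rw [show μ * (μ * (2 ^ r * (μ ^ (2 * j) * l))) = 2 ^ r * (μ ^ (2 * (j + 1)) * l) by ring]
    abel

theorem loop_run_nsmul {M : Program} (hM : M.TestFree) {u w γ : Config}
    (h : M.Run (u + γ) (w + γ)) (i : ℕ) (δ : Config) :
    (loop M).Run (i • u + γ + δ) (i • w + γ + δ) := by
  induction i generalizing δ with
  | zero => simpa only [zero_nsmul] using loop_run_self M _
  | succ i ih =>
    refine .head (h.of_eq_add hM (i • u + δ) ?_ rfl)
      ((ih (w + δ)).of_eq_add (M := loop M) hM 0 ?_ ?_)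
    · rw [succ_nsmul]; abel
    · abel
    · rw [succ_nsmul]; abel

theorem keepUnit_run (k : ℕ) : keepUnit.Run (single 0 1 + single 3 k + single 6 k)
    (single 2 1 + single 5 (k + 1) + single 6 k) := by
  have hloop := ((((replaces_inc 5).incs 7 1).dec_seq 3).dec_seq 6).loop_run k
    (single 2 1 + single 5 1)
  refine ⟨single 3 k + single 6 k, run_dec.2 (by abel), _, run_inc.2 rfl, _, run_inc.2 rfl,
    _, hloop.of_eq_add (by simp [TestFree]) 0 ?_ rfl,
    (move_run 7 6 k (single 2 1 + single 5 (k + 1))).of_eq_add (by simp [move, TestFree]) 0 ?_ ?_⟩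
  · simp only [smul_add, smul_single, smul_eq_mul, mul_one, zero_add]
    abel
  · simp only [smul_add, smul_single, smul_eq_mul, mul_one, single_add]
    abel
  · rw [add_zero]

theorem dropUnit_run (k : ℕ) :
    dropUnit.Run (single 0 1 + single 3 k + single 6 k) (single 6 k) := by
  have hloop := (((replaces_inc 7).dec_seq 3).dec_seq 6).loop_run k 0
  have hmove := move_run 7 6 k 0
  refine ⟨single 3 k + single 6 k, run_dec.2 (by abel), _, ?_, by simpa using hmove⟩
  simpa using hloop

theorem settle_run (k l r : ℕ) : settle.Run
    (single 0 (l + r) + single 3 (k * (l + r)) + single 6 (k + 1))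
    (single 2 l + single 5 ((k + 1) * l) + single 6 (k + 1)) := by
  have hkeep := loop_run_nsmul testFree_keepUnit (keepUnit_run k) l
    (r • (single 0 1 + single 3 k))
  have hdrop := loop_run_nsmul (w := 0) testFree_dropUnit
    (by simpa using dropUnit_run k) r (l • (single 2 1 + single 5 (k + 1)))
  refine ⟨single 0 (l + r) + single 3 (k * (l + r)) + single 6 k, run_dec.2 ?_,
    _, hkeep.of_eq_add (M := loop keepUnit) testFree_keepUnit 0 ?_ rfl,
    _, hdrop.of_eq_add (M := loop dropUnit) testFree_dropUnit 0 ?_ rfl,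
    run_inc.2 ?_⟩
  · rw [single_add 6, ← add_assoc]
  · rw [mul_comm k, Nat.add_mul]
    simp only [smul_add, smul_single, smul_eq_mul, mul_one, single_add]
    abel
  · abel
  · rw [mul_comm _ l]
    simp only [smul_add, smul_single, smul_eq_mul, mul_one, smul_zero, single_add 6]
    abel

theorem expo_settle_run {μ : ℕ} (hμ : 1 ≤ μ) (V : ℕ) {l l' : ℕ} (hl : l ≤ l') :
    (seq (expo μ) settle).Run (single 0 (2 ^ V * l') +
      single 1 ((∑ j ∈ Finset.range (2 * V), μ ^ j) * (2 ^ V * l')) + single 4 V)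
      (single 2 l + single 5 (2 ^ V * l) + single 6 (2 ^ V)) := by
  obtain ⟨k, hk⟩ : ∃ k, 2 ^ V = k + 1 := Nat.exists_eq_add_one.2 (by positivity)
  obtain ⟨r, hr⟩ := Nat.exists_eq_add_of_le
    (hl.trans (Nat.le_mul_of_pos_left l' (Nat.pow_pos (n := 2 * V) hμ)))
  have hexpo := loop_expoStep_run hμ V l'
  have hsettle := settle_run k l r
  rw [hr, powered, powered, hk, Nat.add_sub_cancel, ← hk] at hexpo
  rw [← hk] at hsettle
  refine ⟨_, ⟨_, run_inc.2 rfl, ?_⟩, hsettle⟩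
  convert hexpo using 1
  simp only [pow_zero, tsub_self, zero_mul, single_zero, add_zero]
  abel

/-! ### The preamplifiers -/

/-- Add `1`, `a`, `b` to the counters `0`, `1`, `o`. -/
def startBody (a b o : ℕ) : Program := incs 1 a (incs o b (inc 0))

/-- Put `v` to the exponent and a common positive multiple of `1`, `a`, `b` to the counters `0`,
`1`, `o`, then run `P`. -/
def start (v a b o : ℕ) (P : Program) : Program :=
  incs 4 v (seq (startBody a b o) (seq (loop (startBody a b o)) P))

/-- `k` copies of the amplifier `amp i 1`, followed by `P`. -/
def amps (i : ℕ) : ℕ → Program → Program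
  | 0, P => P
  | k + 1, P => seq (amp i 1) (amps i k P)

/-- The test-free part of the preamplifier for `d = e + 1`. The lowest one needs no amplifier since
`fastF 2` is computed by the machine; the others apply `fastF (e + 2)` to the exponent `n + 1`
times, return the content of all budgets to `1`, and evaluate the exponent. -/
def mainPart : ℕ → ℕ → Program
  | 0, n => start (fastF 2 n) (2 * fastF 2 n) 0 0 (seq (expo 1) settle)
  | e + 1, n => start n (4 ^ n - 1) ((n + 2) * 4 ^ n) (budget (e + 2))
      (amps (e + 1) (n + 1) (seq (step 1 1 0 1 2 3 (budget (e + 2)) 1) (seq (expo 2) settle)))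

/-- The counters tested by the preamplifier for `d = e + 1`. -/
def finalTests (e : ℕ) : List ℕ := 0 :: 1 :: 3 :: (List.range (e + 1)).map fun k => budget (k + 1)

/-- The preamplifier for `d = e + 1`. -/
def preamp (e n : ℕ) : Program := withTests (mainPart e n) (finalTests e)

@[grind =]
theorem mem_finalTests {e z : ℕ} :
    z ∈ finalTests e ↔ z = 0 ∨ z = 1 ∨ z = 3 ∨ ∃ k ≤ e, z = budget (k + 1) := by
  simp [finalTests, eq_comm]

/-! ### Counters of the preamplifiers -/

theorem testFree_amps (i k : ℕ) {P : Program} (h : P.TestFree) : (amps i k P).TestFree := by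
  induction k with
  | zero => exact h
  | succ k ih => exact ⟨testFree_amp _ _, ih⟩

theorem testFree_start (v a b o : ℕ) {P : Program} (h : P.TestFree) :
    (start v a b o P).TestFree := by
  simp [start, startBody, TestFree, h]

theorem testFree_mainPart (e n : ℕ) : (mainPart e n).TestFree := by
  have hend (μ : ℕ) : (seq (expo μ) settle).TestFree := ⟨testFree_expo μ, testFree_settle⟩
  cases e with
  | zero => exact testFree_start _ _ _ _ (hend 1)
  | succ e => exact testFree_start _ _ _ _ (testFree_amps _ _ ⟨testFree_step .., hend 2⟩)

theorem counters_startBody_subset (a b o : ℕ) : (startBody a b o).counters ⊆ {0, 1, o} := by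
  rw [startBody, counters_incs, counters_incs, counters]
  split_ifs <;> grind

theorem counters_start {v a b o : ℕ} {P : Program} (h : {0, 1, 4, o} ⊆ P.counters) :
    (start v a b o P).counters = P.counters := by
  have hbody := counters_startBody_subset a b o
  rw [start, counters_incs]
  simp only [counters]
  split_ifs <;> grind

theorem counters_amps (i k : ℕ) (P : Program) :
    (amps i (k + 1) P).counters = Finset.range (8 + 2 * i) ∪ P.counters := by
  induction k with
  | zero => rw [amps, counters, amps, counters_amp]
  | succ k ih => rw [amps, counters, ih, counters_amp, ← Finset.union_assoc, Finset.union_self]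

theorem counters_expo_settle (μ : ℕ) : (seq (expo μ) settle).counters = Finset.range 8 := by
  rw [counters, counters_expo, counters_settle]
  decide

theorem counters_mainPart (e n : ℕ) : (mainPart e n).counters = Finset.range (8 + 2 * e) := by
  cases e with
  | zero =>
    rw [mainPart, counters_start, counters_expo_settle]
    rw [counters_expo_settle]
    decide
  | succ e =>
    have hrest : (amps (e + 1) (n + 1) (seq (step 1 1 0 1 2 3 (budget (e + 2)) 1)
        (seq (expo 2) settle))).counters = Finset.range (8 + 2 * (e + 1)) := by
      rw [counters_amps, counters, counters_expo_settle, counters_step le_rfl]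
      grind
    rw [mainPart, counters_start, hrest]
    grind

theorem counters_tests (c : ℕ) (cs : List ℕ) : (tests c cs).counters = (c :: cs).toFinset := by
  induction cs generalizing c with
  | nil => rfl
  | cons c' cs ih =>
    rw [tests, counters, counters, ih, List.toFinset_cons (a := c), Finset.insert_eq]

theorem tested_tests (c : ℕ) (cs : List ℕ) : (tests c cs).tested = (c :: cs).toFinset := by
  induction cs generalizing c with
  | nil => rfl
  | cons c' cs ih =>
    rw [tests, tested, tested, ih, List.toFinset_cons (a := c), Finset.insert_eq]

theorem tested_of_testFree {M : Program} (h : M.TestFree) : M.tested = ∅ := by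
  induction M with
  | inc c => rfl
  | dec c => rfl
  | test c => exact h.elim
  | loop M ih => exact ih h
  | seq M N ihM ihN => rw [tested, ihM h.1, ihN h.2, Finset.union_empty]
  | or M N ihM ihN => rw [tested, ihM h.1, ihN h.2, Finset.union_empty]

theorem counters_preamp (e n : ℕ) : (preamp e n).counters = Finset.range (8 + 2 * e) := by
  rw [preamp, finalTests, withTests, counters, counters_mainPart, counters_tests, ← finalTests,
    Finset.union_eq_left]
  intro z hz
  rw [List.mem_toFinset, mem_finalTests] at hz
  grind

theorem tested_preamp (e n : ℕ) : (preamp e n).tested = (finalTests e).toFinset := by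
  rw [preamp, finalTests, withTests, tested, tested_of_testFree (testFree_mainPart e n),
    tested_tests, Finset.empty_union]

theorem dimension_preamp (e n : ℕ) : (preamp e n).dimension = 2 * (e + 1) + 6 := by
  rw [dimension, counters_preamp, Finset.card_range]
  ring

theorem safe_preamp (e n : ℕ) : (preamp e n).safe 2 5 6 =
    insert 4 ((Finset.range e).image fun k => control (k + 1)) := by
  ext z
  simp only [safe, counters_preamp, tested_preamp, Finset.mem_sdiff, Finset.mem_range,
    Finset.mem_union, Finset.mem_insert, Finset.mem_singleton, List.mem_toFinset, mem_finalTests,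
    Finset.mem_image, budget, control]
  constructor
  · rintro ⟨hz, hsafe⟩
    push Not at hsafe
    obtain ⟨⟨h2, h5, h6⟩, h0, h1, h3, hodd⟩ := hsafe
    have := hodd ((z - 7) / 2)
    by_cases h4 : z = 4
    · exact .inl h4
    · exact .inr ⟨(z - 8) / 2, by omega, by omega⟩
  · rintro (rfl | ⟨k, hk, rfl⟩) <;> grind

theorem card_safe_preamp (e n : ℕ) : ((preamp e n).safe 2 5 6).card = e + 1 := by
  have hinj : Function.Injective fun k => control (k + 1) := fun _ _ h => by grind
  rw [safe_preamp, Finset.card_insert_of_notMem (by grind), Finset.card_image_of_injective _ hinj,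
    Finset.card_range]

/-! ### Runs of the parts of a preamplifier -/

theorem run_tests {c : ℕ} {cs : List ℕ} {α β : Config} :
    (tests c cs).Run α β ↔ β = α ∧ ∀ z ∈ c :: cs, α z = 0 := by
  induction cs generalizing c α with
  | nil => simp [tests, run_test]
  | cons c' cs ih =>
    simp only [tests, run_seq, run_test, ih, List.forall_mem_cons]
    grind

theorem run_preamp {e n : ℕ} {α β : Config} :
    (preamp e n).Run α β ↔ (mainPart e n).Run α β ∧ ∀ z ∈ finalTests e, β z = 0 := by
  simp only [preamp, finalTests, withTests, run_seq, run_tests]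
  grind

theorem startBody_replaces (a b o : ℕ) :
    (startBody a b o).Replaces 0 (single 1 a + (single o b + single 0 1)) :=
  ((replaces_inc 0).incs o b).incs 1 a

theorem run_start {v a b o : ℕ} {P : Program} {β : Config} : (start v a b o P).Run 0 β ↔
    ∃ m, 1 ≤ m ∧ P.Run (single 0 m + single 1 (a * m) + single 4 v + single o (b * m)) β := by
  have hbody := startBody_replaces a b o
  have hconfig (i : ℕ) : single 4 v + (single 1 a + (single o b + single 0 1)) +
      i • (single 1 a + (single o b + single 0 1)) = single 0 (i + 1) + single 1 (a * (i + 1)) +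
        single 4 v + single o (b * (i + 1)) := by
    simp only [smul_add, smul_single, smul_eq_mul, one_mul, mul_add_one, single_add, mul_comm i]
    abel
  rw [start, run_incs, zero_add]
  constructor
  · rintro ⟨ρ, hfirst, τ, hloop, hP⟩
    obtain ⟨γ, hγ, rfl⟩ := (hbody _ _).1 hfirst
    obtain ⟨i, hi⟩ := hbody.exists_nsmul_of_loop hloop
    rw [smul_zero, add_zero] at hi
    rw [add_zero] at hγ
    refine ⟨i + 1, by omega, ?_⟩
    rwa [← hconfig, hγ, ← hi]
  · rintro ⟨m, hm, hP⟩
    obtain ⟨i, rfl⟩ := Nat.exists_eq_add_of_le' hm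
    have hfirst := hbody.run (single 4 v)
    have hloop := hbody.loop_run i (single 4 v + (single 1 a + (single o b + single 0 1)))
    rw [add_zero] at hfirst
    rw [smul_zero, add_zero, hconfig] at hloop
    exact ⟨_, hfirst, _, hloop, hP⟩

theorem run_amps {i k V : ℕ} {P : Program} {α β : Config} (h : (amps i k P).Run α β) :
    ∃ ρ, P.Run ρ β ∧ Paid (balance 1 (pool (i + 1)) (budget (i + 1))) k
      (Clean i V) (Clean i ((fastF (i + 1))^[k] V)) α ρ := by
  induction k generalizing α V with
  | zero => exact ⟨α, h, .of_eq (fun _ => rfl) id⟩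
  | succ k ih =>
    obtain ⟨τ, hamp, hamps⟩ := h
    obtain ⟨ρ, hP, hpaid⟩ := ih (V := fastF (i + 1) V) hamps
    exact ⟨ρ, hP, (amp_pays (bodySpec i) le_rfl V _ _ hamp).trans hpaid⟩

theorem amps_run (i k R V : ℕ) {z : ℕ} (hz : 2 ∣ z) : ∃ X, 2 ∣ X ∧
    4 ^ V * X = 4 ^ (fastF (i + 1))^[k] V * z ∧ ∀ (P : Program) (β : Config),
      P.Run (funded 1 (budget (i + 1)) R ((fastF (i + 1))^[k] V) z) β →
      (amps i k P).Run (funded 1 (budget (i + 1)) (R + k) V X) β := by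
  induction k generalizing V with
  | zero => exact ⟨z, hz, rfl, fun P β h => h⟩
  | succ k ih =>
    obtain ⟨Y, hY, hYz, hamps⟩ := ih (fastF (i + 1) V)
    obtain ⟨X, hX, hXY, hamp⟩ := amp_run (bodyRun i) (one_dvd 2) (R + k) V Y hY
    rw [one_mul] at hXY
    exact ⟨X, hX, hXY.trans hYz, fun P β h => ⟨_, hamp, hamps P β h⟩⟩

/-- The configuration in which `expo μ` can exactly compute the power with exponent `V` from
`X` in `0`. -/
noncomputable def expoInput (μ V X : ℕ) : Config :=
  single 0 X + single 1 ((∑ i ∈ Finset.range (2 * V), μ ^ i) * X) + single 4 V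

theorem expoStart_expoInput (μ V : ℕ) {X : ℕ} (hX : 1 ≤ X) : ExpoStart μ V (expoInput μ V X) := by
  constructor <;> simp [expoInput, single_apply, hX]

theorem two_pow_geom_sum (V : ℕ) : ∑ i ∈ Finset.range (2 * V), 2 ^ i = 4 ^ V - 1 := by
  rw [Nat.geomSum_eq le_rfl, pow_mul]
  simp

theorem scaled_eq_expoInput (V X : ℕ) : scaled V X = expoInput 2 V X := by
  rw [expoInput, two_pow_geom_sum, scaled]

theorem run_mainPart_zero {n : ℕ} {β : Config} : (mainPart 0 n).Run 0 β ↔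
    ∃ X, 1 ≤ X ∧ (seq (expo 1) settle).Run (expoInput 1 (fastF 2 n) X) β := by
  simp [mainPart, run_start, expoInput]

theorem run_mainPart_succ {e n : ℕ} {β : Config} : (mainPart (e + 1) n).Run 0 β ↔
    ∃ X, 1 ≤ X ∧ (amps (e + 1) (n + 1) (seq (step 1 1 0 1 2 3 (budget (e + 2)) 1)
      (seq (expo 2) settle))).Run (funded 1 (budget (e + 2)) (n + 2) n X) β := by
  simp [mainPart, run_start, funded, scaled, mul_assoc]

/-! ### Correctness of the preamplifiers -/

theorem total_funded (i μ R v X : ℕ) :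
    total (pool i) (funded μ (budget i) R v X) = 4 ^ v * X := by
  obtain ⟨k, hk⟩ := exists_four_pow_eq_succ v
  have h0 : 0 ∈ pool i := by grind
  have h1 : 1 ∈ pool i := by grind
  have h4 : 4 ∉ pool i := by grind
  have hi : budget i ∉ pool i := by grind
  simp only [funded, scaled, total_add, total_single, h0, h1, h4, hi, if_true, if_false, hk]
  rw [Nat.add_sub_cancel]
  ring

theorem balance_funded (i μ R v X : ℕ) :
    balance μ (pool i) (budget i) R (funded μ (budget i) R v X) = 0 := by
  have hbudget : funded μ (budget i) R v X (budget i) =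
      (∑ j ∈ Finset.range R, μ ^ j) * (4 ^ v * X) := by
    simp only [funded, scaled, Finsupp.add_apply, single_apply]
    grind
  rw [balance, total_funded, hbudget]
  push_cast
  ring

theorem clean_funded (i μ R v : ℕ) {X : ℕ} (hX : 1 ≤ X) :
    Clean i v (funded μ (budget (i + 1)) R v X) := by
  have happly {z : ℕ} (hz : z ≠ budget (i + 1)) :
      funded μ (budget (i + 1)) R v X z = scaled v X z := by
    rw [funded, Finsupp.add_apply, single_eq_of_ne hz, add_zero]
  obtain ⟨k, hk⟩ := exists_four_pow_eq_succ v
  refine fun _ => ⟨⟨?_, ?_, ?_, ?_, ?_⟩, fun j _ => ?_⟩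
  all_goals
    rw [happly (by grind)]
    try rw [happly (by grind)]
    simp only [scaled, Finsupp.add_apply, single_apply, hk, Nat.add_sub_cancel]
    grind

theorem Paid.of_balance_eq_zero {μ o k : ℕ} {Z : Finset ℕ} {P Q : Config → Prop} {α β : Config}
    (h : Paid (balance μ Z o) k P Q α β) (hα : balance μ Z o k α = 0) (hβ : β o = 0)
    (hP : P α) : Q β :=
  (h 0).2 (by rw [zero_add, hα]; simp [balance, hβ]) hP

theorem returnStep_pays (i V : ℕ) : Pays (balance 1 (pool (i + 1)) (budget (i + 1))) 1
    (step 1 1 0 1 2 3 (budget (i + 1)) 1) (Clean i V)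
    (fun β => Ratio V V β ∧ ∀ k ≤ i, β (budget k) = 0 ∧ β (control k) = 0) := by
  refine (stepCounters_incr (i + 1)).pays le_rfl le_rfl fun α β hpass hα => ?_
  obtain ⟨hratio, hcontrol⟩ := hα fun k hk => hpass.eq_zero_of_ne _ (by grind) (by grind)
  obtain ⟨j, hα0, hβ0, hβ1⟩ := hpass.divided hratio.two hratio.three
  rw [one_mul] at hα0 hβ0
  rw [one_mul, tsub_self, zero_mul, add_zero] at hβ1
  refine ⟨⟨?_, ?_, hpass.eq_zero 2 (by grind) (by decide) (by decide),
    hpass.eq_zero 3 (by grind) (by decide) (by decide), ?_⟩, fun k hk => ⟨?_, ?_⟩⟩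
  · exact (hβ0.trans hα0.symm) ▸ hratio.pos
  · rw [hβ0, hβ1, ← hα0, hratio.sum]
  · rw [hpass.frame 4 (by grind), hratio.exponent]
  · exact hpass.eq_zero _ (by grind) (by grind) (by grind)
  · rw [hpass.frame _ (by grind), hcontrol k hk]

/-- The final configuration of a preamplifier for `2 ^ V` with `l` in the counter `x`. -/
noncomputable def output (V l : ℕ) : Config :=
  single 2 l + single 5 (2 ^ V * l) + single 6 (2 ^ V)

theorem budget_succ_mem_finalTests {e k : ℕ} (hk : k ≤ e) : budget (k + 1) ∈ finalTests e :=
  mem_finalTests.2 (.inr (.inr (.inr ⟨k, hk, rfl⟩)))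

theorem mem_finalTests_or_eq {e z : ℕ} (hz : z < 8 + 2 * e) :
    z ∈ finalTests e ∨ z ∈ ({2, 4, 5, 6} : Finset ℕ) ∨
      ∃ k, 1 ≤ k ∧ k ≤ e ∧ z = control k := by
  rw [mem_finalTests]
  rcases Nat.even_or_odd' z with ⟨m, rfl | rfl⟩
  · rcases lt_or_ge m 4 with hm | hm
    · interval_cases m <;> simp
    · exact .inr (.inr ⟨m - 3, by omega, by omega, by grind⟩)
  · rcases lt_or_ge m 3 with hm | hm
    · interval_cases m <;> simp
    · exact .inl (.inr (.inr (.inr ⟨m - 3, by omega, by grind⟩)))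

theorem eq_output {e n μ V : ℕ} (hμ : 1 ≤ μ) {α β : Config} (h : (preamp e n).Run 0 β)
    (hα : ExpoStart μ V α) (hend : (seq (expo μ) settle).Run α β)
    (hcontrol : ∀ k, 1 ≤ k → k ≤ e → α (control k) = 0) : β = output V (β 2) := by
  have htests := (run_preamp.1 h).2
  have hframe {z : ℕ} (hz : 8 ≤ z) : β z = α z :=
    hend.frame (by rw [counters_expo_settle, Finset.mem_range]; omega)
  have hseven := budget_succ_mem_finalTests e.zero_le
  obtain ⟨h4, h6, h5⟩ := expo_settle_sound hμ hα hend fun z hz => htests z (by grind)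
  have hzero (z : ℕ) (h2 : z ≠ 2) (h5 : z ≠ 5) (h6 : z ≠ 6) : β z = 0 := by
    rcases lt_or_ge z (8 + 2 * e) with hz | hz
    · obtain hz | hz | ⟨k, hk, hke, rfl⟩ := mem_finalTests_or_eq hz
      · exact htests z hz
      · obtain rfl : z = 4 := by grind
        exact h4
      · rw [hframe (by grind), hcontrol k hk hke]
    · exact h.frame (by rw [counters_preamp, Finset.mem_range]; omega)
  ext z
  simp only [output, Finsupp.add_apply, single_apply]
  grind

theorem preamp_zero_sound {n : ℕ} {β : Config} (h : (preamp 0 n).Run 0 β) :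
    β = output (fastF 2 n) (β 2) := by
  obtain ⟨X, hX, hend⟩ := run_mainPart_zero.1 (run_preamp.1 h).1
  exact eq_output le_rfl h (expoStart_expoInput 1 _ hX) hend fun k hk hk0 => by omega

theorem expoStart_of_ratio {V : ℕ} {α : Config} (hα : Ratio V V α)
    (h : ∀ z ∈ ({5, 6, 7} : Finset ℕ), α z = 0) : ExpoStart 2 V α where
  pos := hα.pos
  budget := by rw [two_pow_geom_sum, Nat.sub_mul, ← hα.sum, one_mul, Nat.add_sub_cancel_left]
  exponent := hα.exponent
  eq_zero z hz := by
    have := hα.two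
    have := hα.three
    grind

theorem preamp_succ_sound {e n : ℕ} {β : Config} (h : (preamp (e + 1) n).Run 0 β) :
    β = output (fastF (e + 3) n) (β 2) := by
  obtain ⟨hmain, htests⟩ := run_preamp.1 h
  obtain ⟨X, hX, hrun⟩ := run_mainPart_succ.1 hmain
  obtain ⟨ρ, ⟨τ, hreturn, hend⟩, hamps⟩ := run_amps (V := n) hrun
  have hτ : τ (budget (e + 2)) = 0 := by
    rw [← hend.frame (by rw [counters_expo_settle, Finset.mem_range]; grind)]
    exact htests _ (budget_succ_mem_finalTests le_rfl)
  have hpaid := hamps.trans (returnStep_pays (e + 1) _ _ _ hreturn)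
  rw [show 1 + (n + 1) = n + 2 by ring] at hpaid
  obtain ⟨hratio, hzero⟩ :=
    hpaid.of_balance_eq_zero (balance_funded (e + 2) 1 (n + 2) n X) hτ (clean_funded _ _ _ _ hX)
  have hbudget0 := (hzero 0 (Nat.zero_le _)).1
  have hcontrol0 := (hzero 0 (Nat.zero_le _)).2
  have hbudget1 := (hzero 1 (by omega)).1
  exact eq_output one_le_two h (expoStart_of_ratio hratio (by grind)) hend
    fun k _ hk => (hzero k hk).2

theorem output_eq_zero {e : ℕ} (V l : ℕ) : ∀ z ∈ finalTests e, output V l z = 0 := by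
  intro z hz
  simp only [output, Finsupp.add_apply, single_apply]
  grind

theorem preamp_sound {e n : ℕ} {β : Config} (h : (preamp e n).Run 0 β) :
    β = output (fastF (e + 2) n) (β 2) := by
  cases e with
  | zero => exact preamp_zero_sound h
  | succ e => exact preamp_succ_sound h

theorem returnStep_run (o V X : ℕ) : (step 1 1 0 1 2 3 o 1).Run (funded 1 o 1 V X)
    (expoInput 2 V X) := by
  obtain ⟨k, hk⟩ := exists_four_pow_eq_succ V
  refine (step_run le_rfl 1 0 1 2 3 o 1 X ((4 ^ V - 1) * X) (single 4 V)).of_eq_add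
    (testFree_step ..) 0 ?_ ?_
  · rw [funded, scaled, tsub_self, zero_mul, Finset.sum_range_one, pow_zero, hk,
      Nat.add_sub_cancel, show (1 : ℕ) * ((k + 1) * X) = X + (k * X + 0) by ring, one_mul]
    abel
  · rw [← scaled_eq_expoInput, scaled, tsub_self, zero_mul, add_zero, one_mul, one_mul]
    abel_nf

theorem mainPart_run (e n : ℕ) {l : ℕ} (hl : 1 ≤ l) :
    (mainPart e n).Run 0 (output (fastF (e + 2) n) l) := by
  cases e with
  | zero =>
    exact run_mainPart_zero.2 ⟨2 ^ fastF 2 n * l, Nat.mul_pos (by positivity) hl,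
      expo_settle_run le_rfl (fastF 2 n) le_rfl⟩
  | succ e =>
    have hend := expo_settle_run one_le_two (fastF (e + 3) n)
      (Nat.le_mul_of_pos_left l two_pos)
    obtain ⟨X, -, hX, hamps⟩ := amps_run (e + 1) (n + 1) 1 n
      (z := 2 ^ fastF (e + 3) n * (2 * l)) ⟨2 ^ fastF (e + 3) n * l, by ring⟩
    have hX0 : 1 ≤ X := Nat.pos_of_mul_pos_left (a := 4 ^ n) (hX ▸ by positivity)
    refine run_mainPart_succ.2 ⟨X, hX0, ?_⟩
    rw [show n + 2 = 1 + (n + 1) by ring]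
    exact hamps _ _ ⟨_, returnStep_run .., hend⟩

theorem preamp_isPreamplifier (e n : ℕ) :
    (preamp e n).IsPreamplifier (2 ^ fastF (e + 2) n) 2 5 6 where
  x_ne_y := by norm_num
  x_ne_b := by norm_num
  y_ne_b := by norm_num
  checking := ⟨_, _, testFree_mainPart e n, rfl⟩
  sound β h := by
    rw [preamp_sound h]
    simp only [output, Finsupp.add_apply, single_apply]
    grind
  complete l hl :=
    ⟨output (fastF (e + 2) n) l, run_preamp.2 ⟨mainPart_run e n hl, output_eq_zero _ l⟩,
      by simp [output]⟩

/-! ### Words of programs -/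

theorem size_le_length_encode (M : Program) : M.size ≤ M.encode.length := by
  induction M <;> simp only [size, encode, List.length_cons, List.length_append] <;> omega

/-- Rename the counters of a program. -/
def rename (f : ℕ → ℕ) : Program → Program
  | inc c => inc (f c)
  | dec c => dec (f c)
  | test c => test (f c)
  | loop M => loop (M.rename f)
  | seq M N => seq (M.rename f) (N.rename f)
  | or M N => or (M.rename f) (N.rename f)

theorem rename_incs (f : ℕ → ℕ) (c m : ℕ) (P : Program) :
    (incs c m P).rename f = incs (f c) m (P.rename f) := by
  induction m with
  | zero => rfl
  | succ m ih => rw [incs, rename, ih, rename, incs]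

theorem rename_decs (f : ℕ → ℕ) (c m : ℕ) (P : Program) :
    (decs c m P).rename f = decs (f c) m (P.rename f) := by
  induction m with
  | zero => rfl
  | succ m ih => rw [decs, rename, ih, rename, decs]

theorem rename_step (f : ℕ → ℕ) (a μ x y x' y' o t : ℕ) : (step a μ x y x' y' o t).rename f =
    step a μ (f x) (f y) (f x') (f y') (f o) (f t) := by
  simp [step, divide, payBack, move, paidMove, rename, rename_incs, rename_decs]

theorem rename_eq_self {f : ℕ → ℕ} {M : Program} (h : ∀ c ∈ M.counters, f c = c) :
    M.rename f = M := by
  induction M <;> simp_all [rename, counters]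

/-- The beginning of the word of a program of the form `M₁; (M₂; (…; (Mₖ; P)))`, up to `P`. -/
def opening (Ms : List Program) : List ℕ := Ms.flatMap fun M => 4 :: M.encode

theorem opening_cons (M : Program) (Ms : List Program) :
    opening (M :: Ms) = 4 :: (M.encode ++ opening Ms) := rfl

theorem opening_append (Ms Ns : List Program) : opening (Ms ++ Ns) = opening Ms ++ opening Ns :=
  List.flatMap_append

theorem opening_replicate_succ (k : ℕ) (M : Program) :
    opening (.replicate (k + 1) M) = opening [M] ++ opening (.replicate k M) :=
  opening_append [M] _

theorem encode_incs (c k : ℕ) (P : Program) :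
    (incs c k P).encode = opening (.replicate k (inc c)) ++ P.encode := by
  induction k with
  | zero => rfl
  | succ k ih => rw [incs, encode, ih, List.replicate_succ, opening_cons]; simp

theorem encode_amps (i k : ℕ) (P : Program) :
    (amps i k P).encode = opening (.replicate k (amp i 1)) ++ P.encode := by
  induction k with
  | zero => rfl
  | succ k ih => rw [amps, encode, ih, List.replicate_succ, opening_cons]; simp

theorem encode_start (v a b o : ℕ) (P : Program) : (start v a b o P).encode =
    opening (.replicate v (inc 4) ++ [startBody a b o, loop (startBody a b o)]) ++ P.encode := by
  rw [start, encode_incs, opening_append]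
  simp [encode, opening]

theorem encode_tests (c : ℕ) (cs : List ℕ) (c' : ℕ) :
    (tests c (cs ++ [c'])).encode = opening ((c :: cs).map test) ++ [2, c'] := by
  induction cs generalizing c with
  | nil => rfl
  | cons c'' cs ih => rw [List.cons_append, tests, encode, ih]; rfl

/-- The beginning of the word of `amp i μ`, up to the word of `amp (i - 1) 2`. -/
def levelWord (μ i : ℕ) : List ℕ :=
  opening [step 2 μ 0 1 2 3 (budget (i + 1)) (budget i),
    loop (seq (dec 4) (seq (inc (control i)) (inc (control 0)))), inc (control i),
    loop (seq (dec (control 0)) (incr (budget i)))] ++ 3 :: opening [dec (control i)]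

theorem encode_amp_succ (i μ : ℕ) :
    (amp (i + 1) μ).encode = levelWord μ (i + 1) ++ (amp i 2).encode := by
  simp [amp, ampBody, levelWord, opening, encode]

/-- The beginning of the word of `amp k 2`, up to the word of `amp 0 2`. -/
def levelWords : ℕ → List ℕ
  | 0 => []
  | k + 1 => levelWord 2 (k + 1) ++ levelWords k

theorem encode_amp_two (k : ℕ) : (amp k 2).encode = levelWords k ++ (amp 0 2).encode := by
  induction k with
  | zero => rfl
  | succ k ih => rw [encode_amp_succ, ih, levelWords, List.append_assoc]

end Program

namespace Ram

open Function Program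

/-! ### Reasoning about machines -/

theorem Exec.length_out_le {P : Ram} {σ τ : State} {t : ℕ} (h : Exec P σ t τ) :
    τ.out.length ≤ σ.out.length + t := by
  induction h with
  | const | add | sub | load | store => exact Nat.le_succ _
  | write => exact List.length_append.le
  | _ => omega

/-- Within `T` steps, `P` changes the memory from `m` to `m'` and writes `w`. The contents of the
scratch register `2` are disregarded. -/
def Does (P : Ram) (T : ℕ) (m m' : ℕ → ℕ) (w : List ℕ) : Prop :=
  ∀ σ : State, (∀ r, r ≠ 2 → σ.mem r = m r) →
    ∃ t τ, t ≤ T ∧ Exec P σ t τ ∧ (∀ r, r ≠ 2 → τ.mem r = m' r) ∧ τ.out = σ.out ++ w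

section Does

variable {P Q : Ram} {i T U : ℕ} {m m' m'' : ℕ → ℕ} {w w' : List ℕ}

theorem Does.congr (h : P.Does T m m' w) (hT : T ≤ U) (hm : ∀ r, r ≠ 2 → m' r = m'' r)
    (hw : w = w') : P.Does U m m'' w' := fun σ hσ =>
  let ⟨t, τ, ht, hexec, hmem, hout⟩ := h σ hσ
  ⟨t, τ, ht.trans hT, hexec, fun r hr => (hmem r hr).trans (hm r hr), hw ▸ hout⟩

theorem Does.mono (h : P.Does T m m' w) (hT : T ≤ U) : P.Does U m m' w :=
  h.congr hT (fun _ _ => rfl) rfl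

theorem Does.seq (hP : P.Does T m m' w) (hQ : Q.Does U m' m'' w') :
    (P.seq Q).Does (T + U) m m'' (w ++ w') := by
  intro σ hσ
  obtain ⟨t, ρ, ht, hPρ, hρ, hρw⟩ := hP σ hσ
  obtain ⟨u, τ, hu, hQτ, hτ, hτw⟩ := hQ ρ hρ
  exact ⟨t + u, τ, add_le_add ht hu, .seq hPρ hQτ, hτ, by rw [hτw, hρw, List.append_assoc]⟩

theorem does_const (m : ℕ → ℕ) (i k : ℕ) : (const i k).Does 1 m (update m i k) [] := by
  intro σ hσ
  refine ⟨1, _, le_rfl, .const i k σ, fun r hr => ?_, (List.append_nil _).symm⟩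
  simp only [State.set, update_apply, hσ r hr]

theorem does_add (m : ℕ → ℕ) (i j k : ℕ) (hj : j ≠ 2 := by decide) (hk : k ≠ 2 := by decide) :
    (add i j k).Does 1 m (update m i (m j + m k)) [] := by
  intro σ hσ
  refine ⟨1, _, le_rfl, .add i j k σ, fun r hr => ?_, (List.append_nil _).symm⟩
  simp only [State.set, update_apply, hσ r hr, hσ j hj, hσ k hk]

theorem does_sub (m : ℕ → ℕ) (i j k : ℕ) (hj : j ≠ 2 := by decide) (hk : k ≠ 2 := by decide) :
    (sub i j k).Does 1 m (update m i (m j - m k)) [] := by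
  intro σ hσ
  refine ⟨1, _, le_rfl, .sub i j k σ, fun r hr => ?_, (List.append_nil _).symm⟩
  simp only [State.set, update_apply, hσ r hr, hσ j hj, hσ k hk]

theorem Does.ite_true (h : P.Does T m m' w) (h0 : m i ≠ 0) (hi : i ≠ 2 := by decide) :
    (ite i P Q).Does (T + 1) m m' w := by
  intro σ hσ
  obtain ⟨t, τ, ht, hexec, hτ⟩ := h σ hσ
  exact ⟨t + 1, τ, by omega, .ite_true (by rwa [hσ i hi]) hexec, hτ⟩

theorem Does.ite_false (h : Q.Does T m m' w) (h0 : m i = 0) (hi : i ≠ 2 := by decide) :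
    (ite i P Q).Does (T + 1) m m' w := by
  intro σ hσ
  obtain ⟨t, τ, ht, hexec, hτ⟩ := h σ hσ
  exact ⟨t + 1, τ, by omega, .ite_false (by rwa [hσ i hi]) hexec, hτ⟩

theorem does_while_false (h0 : m i = 0) (hi : i ≠ 2) : (Ram.while i P).Does 1 m m [] :=
  fun σ hσ => ⟨1, σ, le_rfl, .while_false (by rwa [hσ i hi]), hσ, (List.append_nil _).symm⟩

theorem Does.while_true (hP : P.Does T m m' w) (hrest : (Ram.while i P).Does U m' m'' w')
    (h0 : m i ≠ 0) (hi : i ≠ 2) : (Ram.while i P).Does (T + U + 1) m m'' (w ++ w') := by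
  intro σ hσ
  obtain ⟨t, ρ, ht, hPρ, hρ, hρw⟩ := hP σ hσ
  obtain ⟨u, τ, hu, hτrest, hτ, hτw⟩ := hrest ρ hρ
  exact ⟨t + u + 1, τ, by omega, .while_true (by rwa [hσ i hi]) hPρ hτrest, hτ,
    by rw [hτw, hρw, List.append_assoc]⟩

end Does

/-- Execute `P` as often as register `i` says. Register `3` has to hold `1`. -/
def times (i : ℕ) (P : Ram) : Ram := .while i (seq P (sub i i 3))

/-- `S k` is the memory and `W k` remains to be written before the last `k` rounds. -/
theorem does_times_update {P : Ram} {i T n : ℕ} {S : ℕ → ℕ → ℕ} {W : ℕ → List ℕ}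
    (h3 : ∀ k, S k 3 = 1) (hW : W 0 = [])
    (h : ∀ k < n, ∃ w, W (k + 1) = w ++ W k ∧
      P.Does T (update (S (k + 1)) i (k + 1)) (update (S k) i (k + 1)) w)
    (hi : i ≠ 2) (hi3 : i ≠ 3) :
    (times i P).Does (n * (T + 2) + 1) (update (S n) i n) (update (S 0) i 0) (W n) := by
  induction n with
  | zero => rw [hW, zero_mul]; exact does_while_false (update_self ..) hi
  | succ n ih =>
    obtain ⟨w, hw, hP⟩ := h n n.lt_add_one
    have hround : (seq P (sub i i 3)).Does (T + 1) (update (S (n + 1)) i (n + 1))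
        (update (S n) i n) w := by
      refine (hP.seq (does_sub _ i i 3 hi)).congr le_rfl (fun r _ => ?_) (List.append_nil _)
      rw [update_self, update_of_ne hi3.symm, h3, update_idem, Nat.add_sub_cancel]
    rw [hw]
    exact (hround.while_true (ih fun k hk => h k (by omega)) (by rw [update_self]; omega) hi).mono
      (by rw [Nat.add_mul]; omega)

theorem does_times {P : Ram} {i T : ℕ} {m : ℕ → ℕ} (S : ℕ → ℕ → ℕ) (W : ℕ → List ℕ)
    (hS : S (m i) = m) (h3 : ∀ k, S k 3 = 1) (hW : W 0 = [])
    (h : ∀ k < m i, ∃ w, W (k + 1) = w ++ W k ∧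
      P.Does T (update (S (k + 1)) i (k + 1)) (update (S k) i (k + 1)) w)
    (hi : i ≠ 2 := by decide) (hi3 : i ≠ 3 := by decide) :
    (times i P).Does (m i * (T + 2) + 1) m (update (S 0) i 0) (W (m i)) := by
  have := does_times_update h3 hW h hi hi3
  rwa [hS, update_eq_self] at this

/-! ### Printing programs -/

/-- Append `k` to the output. -/
def literal (k : ℕ) : Ram := seq (const 2 k) (write 2)

/-- The counter that is printed in place of `c`: the counters from `8` on are placeholders for the
contents of the registers of the same number. -/
def value (m : ℕ → ℕ) (c : ℕ) : ℕ := if c < 8 then c else m c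

/-- Append the counter `value m c` to the output, where `m` is the memory. -/
def printCounter (c : ℕ) : Ram := if c < 8 then literal c else write c

/-- Append the word of a program to the output, with every counter replaced by its `value`. -/
def print : Program → Ram
  | .inc c => seq (literal 0) (printCounter c)
  | .dec c => seq (literal 1) (printCounter c)
  | .test c => seq (literal 2) (printCounter c)
  | .loop M => seq (literal 3) (print M)
  | .seq M N => seq (literal 4) (seq (print M) (print N))
  | .or M N => seq (literal 5) (seq (print M) (print N))

/-- Append the `opening` for a list of programs to the output, with every counter replaced by its
`value`. -/
def printOpening : List Program → Ram
  | [] => const 2 0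
  | M :: Ms => seq (literal 4) (seq (print M) (printOpening Ms))

theorem does_literal (m : ℕ → ℕ) (k : ℕ) : (literal k).Does 2 m m [k] := by
  intro σ hσ
  refine ⟨2, _, le_rfl, .seq (.const 2 k σ) (.write 2 _), fun r hr => ?_, ?_⟩
  · simp only [State.set, update_of_ne hr, hσ r hr]
  · simp only [State.set, update_self]

theorem does_printCounter (m : ℕ → ℕ) (c : ℕ) : (printCounter c).Does 2 m m [value m c] := by
  rw [printCounter, value]
  split_ifs with h
  · exact does_literal m c
  · exact fun σ hσ => ⟨1, _, one_le_two, .write c σ, hσ, by rw [hσ c (by omega)]⟩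

theorem does_print (m : ℕ → ℕ) (M : Program) :
    (print M).Does (4 * M.size) m m (M.rename (value m)).encode := by
  induction M with
  | inc c => exact (does_literal m 0).seq (does_printCounter m c)
  | dec c => exact (does_literal m 1).seq (does_printCounter m c)
  | test c => exact (does_literal m 2).seq (does_printCounter m c)
  | loop M ih => exact ((does_literal m 3).seq ih).mono (by rw [Program.size]; omega)
  | seq M N ihM ihN =>
    exact ((does_literal m 4).seq (ihM.seq ihN)).mono (by rw [Program.size]; omega)
  | or M N ihM ihN =>
    exact ((does_literal m 5).seq (ihM.seq ihN)).mono (by rw [Program.size]; omega)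

theorem rename_value_eq_self {M : Program} (h : M.counters ⊆ Finset.range 8) (m : ℕ → ℕ) :
    M.rename (value m) = M :=
  rename_eq_self fun _ hc => if_pos (Finset.mem_range.1 (h hc))

theorem does_print_closed (m : ℕ → ℕ) {M : Program} (h : M.counters ⊆ Finset.range 8) :
    (print M).Does (4 * M.size) m m M.encode := by
  have := does_print m M
  rwa [rename_value_eq_self h] at this

theorem does_printOpening (m : ℕ → ℕ) (Ms : List Program) :
    (printOpening Ms).Does ((Ms.map fun M => 4 * M.size + 2).sum + 1) m m
      (opening (Ms.map (rename (value m)))) := by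
  induction Ms with
  | nil => exact (does_const m 2 0).congr le_rfl (fun _ hr => update_of_ne hr ..) rfl
  | cons M Ms ih =>
    exact ((does_literal m 4).seq ((does_print m M).seq ih)).mono
      (by rw [List.map_cons, List.sum_cons]; omega)

/-- Append the `opening` of `R[i]` increments of a counter to the output. -/
def printIncs (i c : ℕ) : Ram := times i (printOpening [inc c])

theorem does_printIncs {m : ℕ → ℕ} {i c : ℕ} (h3 : m 3 = 1) (hc : c ≠ i := by decide)
    (hi : i ≠ 2 := by decide) (hi3 : i ≠ 3 := by decide) :
    (printIncs i c).Does (m i * 9 + 1) m (update m i 0)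
      (opening (.replicate (m i) (inc (value m c)))) := by
  refine does_times (T := 7) (fun _ => m) (fun k => opening (.replicate k (inc (value m c)))) rfl
    (fun _ => h3) rfl (fun k _ => ⟨_, opening_replicate_succ k _, ?_⟩) hi hi3
  have hvalue : value (update m i (k + 1)) c = value m c := by
    rw [value, value, update_of_ne hc]
  exact (does_printOpening _ [inc c]).congr le_rfl (fun _ _ => rfl)
    (by simp only [List.map_singleton, rename, hvalue])

/-! ### Printing amplifiers -/

/-- The registers that describe the preamplifier to be printed: `R[5] = d - 1` is the level of its
amplifiers, and `R[8]`, `R[9]`, `R[10]` are the counters that depend on the level, see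
`printLevel`. The registers `3`, `4`, `7` hold constants. -/
structure Ready (e : ℕ) (m : ℕ → ℕ) : Prop where
  three : m 3 = 1
  four : m 4 = 2
  five : m 5 = e
  six : m 6 = budget (e + 1)
  seven : m 7 = 0
  eight : m 8 = budget (e + 1)
  nine : m 9 = control e
  ten : m 10 = budget e

theorem Ready.update {e r : ℕ} {m : ℕ → ℕ} (h : Ready e m) (v : ℕ) (hr : 10 < r := by decide) :
    Ready e (update m r v) := by
  constructor <;> rw [update_of_ne (by omega)]
  exacts [h.three, h.four, h.five, h.six, h.seven, h.eight, h.nine, h.ten]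

/-- The memory `m` with the counters of level `k`. -/
def levelMem (m : ℕ → ℕ) (k : ℕ) : ℕ → ℕ :=
  update (update (update m 8 (budget (k + 1))) 9 (control k)) 10 (budget k)

theorem levelMem_apply (m : ℕ → ℕ) (k : ℕ) {r : ℕ} (hr : r < 8 ∨ 10 < r := by decide) :
    levelMem m k r = m r := by
  rw [levelMem, update_of_ne (by omega), update_of_ne (by omega), update_of_ne (by omega)]

theorem Ready.levelMem_eq {e : ℕ} {m : ℕ → ℕ} (h : Ready e m) : levelMem m e = m := by
  rw [levelMem, ← h.eight, ← h.nine, ← h.ten, update_eq_self, update_eq_self, update_eq_self]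

theorem levelMem_levelMem (m : ℕ → ℕ) (j k : ℕ) : levelMem (levelMem m j) k = levelMem m k := by
  funext r
  simp only [levelMem, update_apply]
  grind

/-- Append the `levelWord` of the current level to the output. -/
def printLevel (μ : ℕ) : Ram :=
  seq (printOpening [step 2 μ 0 1 2 3 8 10,
      loop (.seq (.dec 4) (.seq (.inc 9) (.inc (control 0)))), inc 9,
      loop (.seq (.dec (control 0)) (incr 10))])
    (seq (literal 3) (printOpening [dec 9]))

theorem does_printLevel (m : ℕ → ℕ) (k : ℕ) {μ : ℕ} (hμ : μ ≤ 2) :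
    (printLevel μ).Does 500 (levelMem m k) (levelMem m k) (levelWord μ k) := by
  refine ((does_printOpening _ _).seq ((does_literal _ 3).seq (does_printOpening _ _))).congr ?_
    (fun _ _ => rfl) ?_
  · interval_cases μ <;> decide
  · simp [rename_step, incr, rename, levelWord, value, levelMem, Program.control]

/-- Replace the counters of the current level by those of the next lower level. -/
def lowerLevel : Ram := seq (sub 8 8 4) (seq (sub 9 9 4) (sub 10 10 4))

theorem does_lowerLevel {m : ℕ → ℕ} (h4 : m 4 = 2) (k : ℕ) :
    lowerLevel.Does 3 (levelMem m (k + 1)) (levelMem m k) [] := by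
  refine ((does_sub _ 8 8 4).seq ((does_sub _ 9 9 4).seq (does_sub _ 10 10 4))).congr le_rfl
    (fun r _ => ?_) rfl
  simp only [levelMem, update_apply]
  grind

/-- Restore the counters of the level of the preamplifier. -/
def resetLevel : Ram := seq (add 8 6 7) (seq (sub 9 8 3) (sub 10 9 3))

theorem does_resetLevel {m : ℕ → ℕ} {e : ℕ} (h3 : m 3 = 1) (h6 : m 6 = budget (e + 1))
    (h7 : m 7 = 0) : resetLevel.Does 3 m (levelMem m e) [] := by
  refine ((does_add _ 8 6 7).seq ((does_sub _ 9 8 3).seq (does_sub _ 10 9 3))).congr le_rfl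
    (fun r _ => ?_) rfl
  simp only [levelMem, update_apply]
  grind

/-- Append the `levelWords` for the level `R[15]` to the output. -/
def printLevels : Ram := times 15 (seq (printLevel 2) lowerLevel)

theorem does_printLevels {m : ℕ → ℕ} (h3 : m 3 = 1) (h4 : m 4 = 2) :
    printLevels.Does (m 15 * 505 + 1) (levelMem m (m 15)) (levelMem (update m 15 0) 0)
      (levelWords (m 15)) := by
  have hcomm (k j : ℕ) : update (levelMem m k) 15 j = levelMem (update m 15 j) k := by
    funext r
    simp only [levelMem, update_apply]
    grind
  have h := does_times (i := 15) (m := levelMem m (m 15)) (P := seq (printLevel 2) lowerLevel)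
    (T := 503) (levelMem m) levelWords (by rw [levelMem_apply])
    (fun k => by rw [levelMem_apply, h3]) rfl fun k _ => ⟨_, rfl, ?_⟩
  · rwa [levelMem_apply, hcomm] at h
  · rw [hcomm, hcomm, ← List.append_nil (levelWord ..)]
    exact (does_printLevel _ _ le_rfl).seq (does_lowerLevel (by rwa [update_of_ne (by decide)]) k)

/-- Append the word of the amplifier of the current level to the output. -/
def printAmp : Ram :=
  seq (seq (printLevel 1) (seq lowerLevel (sub 15 5 3)))
    (seq printLevels (seq (print (amp 0 2)) resetLevel))

theorem does_printAmp {m : ℕ → ℕ} {e : ℕ} (h : Ready (e + 1) m) (h15 : m 15 = 0) :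
    printAmp.Does (e * 505 + 1400) m m (amp (e + 1) 1).encode := by
  have hlevel : update (levelMem m e) 15 (levelMem m e 5 - levelMem m e 3) =
      levelMem (update m 15 e) e := by
    rw [levelMem_apply, levelMem_apply, h.five, h.three, Nat.add_sub_cancel]
    funext r
    simp only [levelMem, update_apply]
    grind
  have hfirst := (does_printLevel m (e + 1) one_le_two).seq
    ((does_lowerLevel h.four e).seq (does_sub _ 15 5 3))
  have hlevels := does_printLevels (m := update m 15 e) h.three h.four
  have hbase := does_print_closed (levelMem m 0) (M := amp 0 2) (by rw [counters_amp])
  have hreset := does_resetLevel (m := levelMem m 0) (e := e + 1) h.three h.six h.seven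
  rw [hlevel, h.levelMem_eq] at hfirst
  rw [update_self, update_idem, show update m 15 0 = m from update_eq_self_iff.2 h15.symm]
    at hlevels
  rw [levelMem_levelMem, h.levelMem_eq] at hreset
  refine (hfirst.seq (hlevels.seq (hbase.seq hreset))).congr ?_ (fun _ _ => rfl) ?_
  · have : (amp 0 2).size ≤ 200 := by decide
    omega
  · rw [encode_amp_succ, encode_amp_two e]
    simp only [List.append_nil]

/-- Append the `opening` for the amplifiers of a preamplifier to the output. -/
def printAmps : Ram := times 11 (seq (literal 4) printAmp)

theorem does_printAmps {m : ℕ → ℕ} {e : ℕ} (h : Ready (e + 1) m) (h15 : m 15 = 0) :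
    printAmps.Does (m 11 * (e * 505 + 1404) + 1) m (update m 11 0)
      (opening (.replicate (m 11) (amp (e + 1) 1))) := by
  refine does_times (fun _ => m) (fun k => opening (.replicate k (amp (e + 1) 1))) rfl
    (fun _ => h.three) rfl fun k _ => ⟨_, opening_replicate_succ k _, ?_⟩
  have hword : opening [amp (e + 1) 1] = [4] ++ (amp (e + 1) 1).encode := List.append_nil _
  rw [hword, show e * 505 + 1402 = 2 + (e * 505 + 1400) by ring]
  exact (does_literal _ 4).seq (does_printAmp (h.update (k + 1)) h15)

/-! ### Printing preamplifiers -/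

/-- The registers that describe the preamplifier to be printed before anything is printed:
`R[11] = k` is the number of its amplifiers, and `R[12]`, `R[13]`, `R[14]` are the arguments of
its `start`. -/
structure Prepared (e k v a b : ℕ) (m : ℕ → ℕ) : Prop extends Ready e m where
  eleven : m 11 = k
  twelve : m 12 = v
  thirteen : m 13 = a
  fourteen : m 14 = b

/-- Set up the registers that do not depend on `n`, and the number of amplifiers. -/
def setup : Ram :=
  seq (seq (const 3 1) (seq (const 4 2) (seq (sub 5 0 3) (seq (const 7 0)
    (seq (const 6 5) (seq (add 6 6 0) (seq (add 6 6 0) (add 11 1 3)))))))) resetLevel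

theorem does_setup {m : ℕ → ℕ} {e : ℕ} (h0 : m 0 = e + 1) :
    ∃ m', setup.Does 11 m m' [] ∧ Ready e m' ∧ m' 1 = m 1 ∧ m' 11 = m 1 + 1 := by
  have hset := (does_const m 3 1).seq ((does_const _ 4 2).seq ((does_sub _ 5 0 3).seq
    ((does_const _ 7 0).seq ((does_const _ 6 5).seq ((does_add _ 6 6 0).seq
      ((does_add _ 6 6 0).seq (does_add _ 11 1 3)))))))
  refine ⟨_, (hset.seq (does_resetLevel (e := e) ?_ ?_ ?_)).congr le_rfl (fun _ _ => rfl) rfl,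
    ?_, ?_, ?_⟩
  · simp
  · simp [h0]; ring
  · simp
  · constructor <;> simp [levelMem, h0]
    ring
  · simp [levelMem]
  · simp [levelMem]

/-- Multiply `R[13]` by the power of two with exponent `R[15]`. -/
def doubling : Ram := times 15 (add 13 13 13)

theorem does_doubling {m : ℕ → ℕ} (h3 : m 3 = 1) :
    doubling.Does (m 15 * 3 + 1) m (update (update m 13 (2 ^ m 15 * m 13)) 15 0) [] := by
  refine does_times (T := 1) (fun k => update m 13 (2 ^ (m 15 - k) * m 13)) (fun _ => [])
    (by simp) (fun _ => h3) rfl fun k hk => ⟨[], rfl, ?_⟩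
  refine (does_add _ 13 13 13).congr le_rfl (fun r _ => ?_) rfl
  have hpow : 2 ^ (m 15 - k) = 2 ^ (m 15 - (k + 1)) * 2 := by
    rw [← pow_succ]; congr 1; omega
  simp only [update_apply, hpow]
  grind

/-- Add the product of `R[13]` and `R[15]` to `R[14]`. -/
def multiply : Ram := times 15 (add 14 14 13)

theorem does_multiply {m : ℕ → ℕ} (h3 : m 3 = 1) :
    multiply.Does (m 15 * 3 + 1) m (update (update m 14 (m 14 + m 15 * m 13)) 15 0) [] := by
  refine does_times (T := 1) (fun k => update m 14 (m 14 + (m 15 - k) * m 13)) (fun _ => [])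
    (by simp) (fun _ => h3) rfl fun k hk => ⟨[], rfl, ?_⟩
  refine (does_add _ 14 14 13).congr le_rfl (fun r _ => ?_) rfl
  have hsub : m 15 - k = m 15 - (k + 1) + 1 := by omega
  simp only [update_apply, hsub, Nat.add_mul]
  grind

/-- Set up the arguments of `start` in `mainPart 0 n`. -/
def baseParameters : Ram :=
  seq (const 13 2) (seq (add 15 1 7) (seq doubling (seq (add 14 13 7) (seq (add 15 1 7)
    (seq multiply (seq (sub 12 14 3) (seq (add 13 12 12) (const 14 0))))))))

theorem does_baseParameters {m : ℕ → ℕ} {e : ℕ} (h : Ready e m) : ∃ m',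
    baseParameters.Does (6 * m 1 + 9) m m' [] ∧
      Prepared e (m 11) (fastF 2 (m 1)) (2 * fastF 2 (m 1)) 0 m' := by
  have hdoes := (does_const m 13 2).seq ((does_add _ 15 1 7).seq
    ((does_doubling (by simpa using h.three)).seq ((does_add _ 14 13 7).seq
      ((does_add _ 15 1 7).seq ((does_multiply (by simpa using h.three)).seq
        ((does_sub _ 12 14 3).seq ((does_add _ 13 12 12).seq (does_const _ 14 0))))))))
  have hfastF : 2 ^ m 1 * 2 + m 1 * (2 ^ m 1 * 2) - 1 = fastF 2 (m 1) := by
    rw [← Nat.add_sub_cancel (n := fastF 2 (m 1)) (m := 1), fastF_two]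
    ring_nf
  refine ⟨_, hdoes.congr ?_ (fun _ _ => rfl) rfl, ?_, ?_, ?_, ?_, ?_⟩
  · simp [h.seven]; omega
  · repeat refine Ready.update ?_ _
    exact h
  · simp
  · simp [h.seven, h.three, hfastF]
  · simp [h.seven, h.three, hfastF, ← two_mul]
  · simp

/-- Set up the arguments of `start` in `mainPart (e + 1) n`. -/
def parameters : Ram :=
  seq (const 13 1) (seq (add 15 1 1) (seq doubling (seq (add 14 13 13) (seq (add 15 1 7)
    (seq multiply (seq (sub 13 13 3) (add 12 1 7)))))))

theorem does_parameters {m : ℕ → ℕ} {e : ℕ} (h : Ready e m) : ∃ m',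
    parameters.Does (9 * m 1 + 8) m m' [] ∧
      Prepared e (m 11) (m 1) (4 ^ m 1 - 1) ((m 1 + 2) * 4 ^ m 1) m' := by
  have hdoes := (does_const m 13 1).seq ((does_add _ 15 1 1).seq
    ((does_doubling (by simpa using h.three)).seq ((does_add _ 14 13 13).seq
      ((does_add _ 15 1 7).seq ((does_multiply (by simpa using h.three)).seq
        ((does_sub _ 13 13 3).seq (does_add _ 12 1 7)))))))
  have hpow : 2 ^ (m 1 + m 1) = 4 ^ m 1 := by rw [← two_mul, pow_mul]; rfl
  refine ⟨_, hdoes.congr ?_ (fun _ _ => rfl) rfl, ?_, ?_, ?_, ?_, ?_⟩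
  · simp [h.seven]; omega
  · repeat refine Ready.update ?_ _
    exact h
  · simp
  · simp [h.seven]
  · simp [h.three, hpow]
  · simp [h.seven, hpow]; ring

/-- Append the word of the `startBody` with arguments `R[13]`, `R[14]`, `R[8]` to the output. -/
def printBody : Ram :=
  seq (add 15 13 7) (seq (printIncs 15 1) (seq (add 15 14 7) (seq (printIncs 15 8)
    (print (.inc 0)))))

theorem does_printBody {m : ℕ → ℕ} {e k v a b : ℕ} (h : Prepared e k v a b m) :
    printBody.Does (9 * (a + b) + 8) m (update m 15 0) (startBody a b (budget (e + 1))).encode := by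
  have hdoes := (does_add m 15 13 7).seq ((does_printIncs (i := 15) (c := 1)
    (by simpa using h.three)).seq ((does_add _ 15 14 7).seq ((does_printIncs (i := 15) (c := 8)
      (by simpa using h.three)).seq (does_print_closed _ (M := .inc 0) (by decide)))))
  refine hdoes.congr ?_ (fun r _ => by simp) ?_
  · simp [h.seven, h.thirteen, h.fourteen, Program.size]; omega
  · simp [startBody, encode_incs, value, h.seven, h.eight, h.thirteen, h.fourteen]

/-- Append the beginning of the word of the `start` with arguments `R[12]`, `R[13]`, `R[14]`,
`R[8]` to the output. -/
def printStart : Ram :=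
  seq (printIncs 12 4) (seq (literal 4) (seq printBody (seq (literal 4) (seq (literal 3)
    printBody))))

theorem does_printStart {m : ℕ → ℕ} {e k v a b : ℕ} (h : Prepared e k v a b m) :
    printStart.Does (9 * v + 18 * (a + b) + 23) m (update (update m 12 0) 15 0)
      (opening (.replicate v (.inc 4) ++ [startBody a b (budget (e + 1)),
        loop (startBody a b (budget (e + 1)))])) := by
  have hfirst : Prepared e k 0 a b (update m 12 0) := {
    h.toReady.update 0 with
    eleven := h.eleven
    twelve := update_self ..
    thirteen := h.thirteen
    fourteen := h.fourteen }
  have hsecond : Prepared e k 0 a b (update (update m 12 0) 15 0) := {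
    hfirst.toReady.update 0 with
    eleven := h.eleven
    twelve := rfl
    thirteen := h.thirteen
    fourteen := h.fourteen }
  have hdoes := (does_printIncs (i := 12) (c := 4) h.three).seq ((does_literal _ 4).seq
    ((does_printBody hfirst).seq ((does_literal _ 4).seq ((does_literal _ 3).seq
      (does_printBody hsecond)))))
  refine hdoes.congr ?_ (fun r _ => by simp) ?_
  · rw [h.twelve]; omega
  · simp [opening, encode, value, h.twelve]

/-- Append the words of the tests of `budget 1` to `budget R[5]` to the output. -/
def printBudgetTests : Ram := times 5 (seq (printOpening [test 16]) (add 16 16 4))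

theorem does_printBudgetTests {m : ℕ → ℕ} (h3 : m 3 = 1) (h4 : m 4 = 2) (h16 : m 16 = budget 1) :
    printBudgetTests.Does (m 5 * 10 + 1) m (update (update m 16 (budget (m 5 + 1))) 5 0)
      (opening ((List.range (m 5)).map fun k => test (budget (k + 1)))) := by
  have hrange : List.range (m 5) = List.range' (m 5 - m 5) (m 5) := by
    rw [Nat.sub_self, List.range_eq_range']
  rw [hrange]
  refine does_times (T := 8) (fun k => update m 16 (budget (m 5 - k + 1)))
    (fun k => opening ((List.range' (m 5 - k) k).map fun j => test (budget (j + 1))))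
    (update_eq_self_iff.2 (by rw [Nat.sub_self, h16])) (fun _ => h3) rfl
    fun k hk => ⟨[4, 2, budget (m 5 - k)], ?_, ?_⟩
  · rw [List.range'_succ, List.map_cons, opening_cons,
      show m 5 - (k + 1) + 1 = m 5 - k by omega]
    rfl
  · refine ((does_printOpening _ [test 16]).seq (does_add _ 16 16 4)).congr le_rfl
      (fun r _ => ?_) ?_
    · simp only [update_apply]
      grind
    · simp [rename, value, opening, encode]
      grind

/-- Append the word of the tests of a preamplifier to the output. -/
def printTests : Ram :=
  seq (printOpening [test 0, test 1, test 3]) (seq (const 16 (budget 1))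
    (seq printBudgetTests (print (test 16))))

theorem does_printTests {m : ℕ → ℕ} {e : ℕ} (h : Ready e m) : ∃ m',
    printTests.Does (10 * e + 25) m m'
      (tests 0 (1 :: 3 :: (List.range (e + 1)).map fun k => budget (k + 1))).encode := by
  have hdoes := (does_printOpening m [test 0, test 1, test 3]).seq
    ((does_const m 16 (budget 1)).seq ((does_printBudgetTests (m := update m 16 (budget 1))
      h.three h.four (update_self ..)).seq (does_print _ (test 16))))
  refine ⟨_, hdoes.congr ?_ (fun _ _ => rfl) ?_⟩
  · simp [h.five, Program.size]; omega
  · have hlist : 1 :: 3 :: (List.range (e + 1)).map (fun k => budget (k + 1)) =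
        (1 :: 3 :: (List.range e).map fun k => budget (k + 1)) ++ [budget (e + 1)] := by
      rw [List.range_succ, List.map_append]; rfl
    rw [hlist, encode_tests]
    simp [h.five, rename, value, opening, encode, Function.comp_def]

/-- Append the word of the part of a preamplifier between its `start` and its tests to the
output. -/
def printEnd : Ram :=
  ite 5 (seq printAmps (print (.seq (step 1 1 0 1 2 3 8 1) (.seq (expo 2) settle))))
    (print (.seq (expo 1) settle))

theorem does_printEnd_zero {m : ℕ → ℕ} (h : Ready 0 m) :
    printEnd.Does 801 m m (Program.seq (expo 1) settle).encode := by
  have hsize : (Program.seq (expo 1) settle).size ≤ 200 := by decide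
  refine Does.ite_false ((does_print_closed m ?_).mono (by omega)) h.five
  rw [counters_expo_settle]

theorem does_printEnd_succ {m : ℕ → ℕ} {e : ℕ} (h : Ready (e + 1) m) (h15 : m 15 = 0) :
    printEnd.Does (m 11 * (e * 505 + 1404) + 1202) m (update m 11 0)
      (amps (e + 1) (m 11)
        (.seq (step 1 1 0 1 2 3 (budget (e + 2)) 1) (.seq (expo 2) settle))).encode := by
  have hdoes := (does_printAmps h h15).seq
    (does_print _ (.seq (step 1 1 0 1 2 3 8 1) (.seq (expo 2) settle)))
  have hsize : (Program.seq (step 1 1 0 1 2 3 8 1) (.seq (expo 2) settle)).size ≤ 300 := by decide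
  refine Does.ite_true (hdoes.congr (by omega) (fun _ _ => rfl) ?_) (by rw [h.five]; omega)
  rw [encode_amps, rename, rename_step, rename_value_eq_self (by rw [counters_expo_settle])]
  simp [value, h.eight]

/-- Append the word of the `mainPart` to the output. -/
def printMain : Ram := seq (ite 5 parameters baseParameters) (seq printStart printEnd)

/-- The number of steps of `printMain`. -/
def mainTime : ℕ → ℕ → ℕ
  | 0, n => 6 * n + 45 * fastF 2 n + 834
  | e + 1, n => 18 * n + 18 * ((n + 3) * 4 ^ n) + (n + 1) * (e * 505 + 1404) + 1234

theorem does_printMain {m : ℕ → ℕ} {e : ℕ} (h : Ready e m) (h11 : m 11 = m 1 + 1) : ∃ m',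
    printMain.Does (mainTime e (m 1)) m m' (mainPart e (m 1)).encode ∧ Ready e m' := by
  cases e with
  | zero =>
    obtain ⟨m₁, hparameters, hprepared⟩ := does_baseParameters h
    have hready := (hprepared.toReady.update (r := 12) 0).update (r := 15) 0
    refine ⟨_, ((hparameters.ite_false h.five).seq ((does_printStart hprepared).seq
      (does_printEnd_zero hready))).congr ?_ (fun _ _ => rfl) ?_, hready⟩
    · rw [mainTime]; omega
    · rw [mainPart, encode_start, List.nil_append]; rfl
  | succ e =>
    obtain ⟨m₁, hparameters, hprepared⟩ := does_parameters h
    have hready := (hprepared.toReady.update (r := 12) 0).update (r := 15) 0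
    have hcount : update (update m₁ 12 0) 15 0 11 = m 1 + 1 := hprepared.eleven.trans h11
    have hend := does_printEnd_succ hready (update_self ..)
    rw [hcount] at hend
    refine ⟨_, ((hparameters.ite_true (by rw [h.five]; omega)).seq ((does_printStart hprepared).seq
      hend)).congr ?_ (fun _ _ => rfl) ?_, hready.update 0⟩
    · have hpow : 0 < 4 ^ m 1 := by positivity
      rw [mainTime, show (m 1 + 3) * 4 ^ m 1 = (m 1 + 2) * 4 ^ m 1 + 4 ^ m 1 by ring]
      omega
    · rw [mainPart, encode_start, List.nil_append]

/-- The machine that prints the preamplifiers. -/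
def printPreamp : Ram := seq setup (seq (literal 4) (seq printMain printTests))

theorem does_printPreamp {m : ℕ → ℕ} {e : ℕ} (h0 : m 0 = e + 1) : ∃ m',
    printPreamp.Does (mainTime e (m 1) + 10 * e + 38) m m' (preamp e (m 1)).encode := by
  obtain ⟨m₁, hsetup, hready, h1, h11⟩ := does_setup h0
  obtain ⟨m₂, hmain, hready'⟩ := does_printMain hready (h11.trans (by rw [h1]))
  obtain ⟨m₃, htests⟩ := does_printTests hready'
  rw [h1] at hmain
  exact ⟨m₃, (hsetup.seq ((does_literal m₁ 4).seq (hmain.seq htests))).congr (by omega)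
    (fun _ _ => rfl) rfl⟩

theorem Does.outputs {P : Ram} {T d n : ℕ} {m' : ℕ → ℕ} {w : List ℕ}
    (h : P.Does T (initial d n).mem m' w) : ∃ t ≤ T, P.Outputs d n t w := by
  obtain ⟨t, τ, ht, hexec, _, hout⟩ := h (initial d n) fun _ _ => rfl
  exact ⟨t, ht, τ, hexec, hout⟩

theorem Outputs.length_le {P : Ram} {d n t : ℕ} {w : List ℕ} (h : P.Outputs d n t w) :
    w.length ≤ t := by
  obtain ⟨τ, hexec, rfl⟩ := h
  simpa only [initial, List.length_nil, Nat.zero_add] using hexec.length_out_le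

theorem mainTime_add_le (e : ℕ) {n : ℕ} (hn : 1 ≤ n) :
    mainTime e n + 10 * e + 38 ≤ 6000 * (n * (e + 1) * 4 ^ n) := by
  have hpow : 1 ≤ 4 ^ n := Nat.one_le_pow _ _ (by norm_num)
  cases e with
  | zero =>
    have hfastF := fastF_two_le hn
    have hn' : n ≤ n * 4 ^ n := Nat.le_mul_of_pos_right n hpow
    rw [mainTime, zero_add, mul_one]
    omega
  | succ e =>
    have hstart : (n + 3) * 4 ^ n ≤ 4 * (n * (e + 2) * 4 ^ n) := by
      rw [← mul_assoc]
      gcongr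
      nlinarith
    have hamps : (n + 1) * (e * 505 + 1404) ≤ 1404 * 2 * (n * (e + 2)) := by nlinarith
    have hlinear : n * (e + 2) ≤ n * (e + 2) * 4 ^ n := Nat.le_mul_of_pos_right _ hpow
    have hn' : n ≤ n * (e + 2) := Nat.le_mul_of_pos_right n (by omega)
    have he : e + 2 ≤ n * (e + 2) := Nat.le_mul_of_pos_left _ hn
    rw [mainTime, add_assoc e 1 1, one_add_one_eq_two]
    omega

theorem printPreamp_outputs (e n : ℕ) : ∃ t, printPreamp.Outputs (e + 1) n t (preamp e n).encode ∧
    (1 ≤ n → t ≤ 6000 * (n * (e + 1) * 4 ^ n)) := by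
  obtain ⟨m, hdoes⟩ := does_printPreamp (m := (initial (e + 1) n).mem) rfl
  obtain ⟨t, ht, h⟩ := hdoes.outputs
  exact ⟨t, h, fun hn => ht.trans (mainTime_add_le e hn)⟩

end Ram

theorem mainTheorem4 :
    ∃ (P : Ram) (C x y b : ℕ), ∀ d n : ℕ, 1 ≤ d →
      ∃ (A : Program) (t : ℕ),
        P.Outputs d n t A.encode ∧
        A.IsPreamplifier (2 ^ fastF (d + 1) n) x y b ∧
        A.dimension = 2 * d + 6 ∧
        (A.safe x y b).card = d ∧
        (1 ≤ n → t ≤ C * (n * d * 4 ^ n) ∧ A.size ≤ C * (n * d * 4 ^ n)) := by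
  refine ⟨Ram.printPreamp, 6000, 2, 5, 6, fun d n hd => ?_⟩
  obtain ⟨e, rfl⟩ : ∃ e, d = e + 1 := ⟨d - 1, by omega⟩
  obtain ⟨t, houtputs, ht⟩ := Ram.printPreamp_outputs e n
  exact ⟨Program.preamp e n, t, houtputs, Program.preamp_isPreamplifier e n,
    Program.dimension_preamp e n, Program.card_safe_preamp e n, fun hn => ⟨ht hn,
      ((Program.size_le_length_encode _).trans houtputs.length_le).trans (ht hn)⟩⟩
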